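/- Let $\lambda>0$, $\sigma_w^2>0$, and let $\sigma_m^2\ge 0$ ($m\in\mathbb Z$) satisfy $P:=\sum_{m}\sigma_m^2<\infty$. Let $\beta_m\sim\mathcal{CN}(0,\sigma_m^2)$ ($m\in\mathbb Z$) be independent circular complex Gaussian variables and let $w_x\sim\mathcal{CN}(0,\sigma_w^2)$ ($x\in\mathbb R$) be independent noise variables, independent of $(\beta_m)_m$. With $\operatorname{sinc}(t)=\frac{\sin \pi t}{\pi t}$ and a finite set $\mathcal M\subset\mathbb Z$, define for every finite set $\mathcal S\subset\mathbb R$ of sensor positions the measurement vectors of the infinite and of the truncated model, $$\tilde{\boldsymbol f}_{\mathcal S}=\Big(\sum_{m\in\mathbb Z}\operatorname{sinc}\big(m+\tfrac{2}{\lambda}x\big)\beta_m+w_x\Big)_{x\in\mathcal S},\qquad \hat{\boldsymbol f}_{\mathcal S}=\Big(\sum_{m\in\mathcal M}\operatorname{sinc}\big(m+\tfrac{2}{\lambda}x\big)\beta_m+w_x\Big)_{x\in\mathcal S},$$ and let $\boldsymbol\beta=(\beta_m)_{m\in\mathcal M}$. Let $I(\cdot\,;\cdot)$ denote mutual information in nats.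 Let $\epsilon=\sum_{m\notin\mathcal M}\sigma_m^2$ and let $N$ be a number of sensors with $\epsilon N^{3/2}<\sigma_w^2$. Let $\mathcal A\subseteq\mathbb R$ be an aperture, $\delta>0$, and let $\mathcal V\subseteq\mathcal A$ be a uniform $\delta$-spaced grid in $\mathcal A$ with at least $N$ points: $\mathcal V=\{x_0,x_0+\delta,\dots,x_0+(K-1)\delta\}$ with $K\ge N$, and every point of $\mathcal A$ is at distance less than $\delta$ from $\mathcal V$ (for an interval $\mathcal A$ and $K\ge 1$ this means $\mathcal V=\mathcal A\cap(x_0+\delta\mathbb Z)$). Let $\mathcal S^{\mathrm{gr}}$ be any set produced by $N$ rounds of the greedy algorithm which starts from $\emptyset$ and in each round adds to the current set $\mathcal S$ an element $x\in\mathcal V\setminus\mathcal S$ that maximizes $I(\hat{\boldsymbol f}_{\mathcal S\cup\{x\}};\boldsymbol\beta)$, with ties broken arbitrarily. Then $I(\tilde{\boldsymbol f}_{\mathcal S};\{\beta_m\})$ and $I(\hat{\boldsymbol f}_{\mathcal S};\boldsymbol\beta)$ are finite for every finite $\mathcal S\subset\mathbb R$, and for every $\mathcal S\subseteq\mathcal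 A$ with $|\mathcal S|\le N$ (hence for every maximizer $\mathcal S^\star$ of $I(\tilde{\boldsymbol f}_{\mathcal S};\{\beta_m\})$ over these sets, and, where no maximizer exists, for the supremum) $$\Big(1-\frac1e\Big)\left[I(\tilde{\boldsymbol f}_{\mathcal S};\{\beta_m\})-N\log\frac{\lambda\sigma_w^2+4\delta P(1+\delta)N^{3/2}}{\lambda\sigma_w^2-\epsilon\lambda N^{3/2}}\right]\le I(\hat{\boldsymbol f}_{\mathcal S^{\mathrm{gr}}};\boldsymbol\beta).$$ -/

import Mathlib

open MeasureTheory ProbabilityTheory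
open scoped NNReal ENNReal

namespace ArrayDesign

noncomputable section

/-- The circular complex Gaussian law `CN(0, v)`: real and imaginary parts are independent and
`N(0, v / 2)`, so that the second absolute moment is `v`. -/
def circularGaussian (v : ℝ≥0) : Measure ℂ :=
  ((gaussianReal 0 (v / 2)).prod (gaussianReal 0 (v / 2))).map
    (fun p : ℝ × ℝ => (p.1 : ℂ) + (p.2 : ℂ) * Complex.I)

/-- Mutual information (in nats) of two random variables: the Kullback-Leibler divergence of
their joint law from the product of their laws. -/
def mutualInfo {Ω α γ : Type*} [MeasurableSpace Ω] [MeasurableSpace α] [MeasurableSpace γ]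
    (X : Ω → α) (Y : Ω → γ) (μ : Measure Ω) : ℝ≥0∞ :=
  InformationTheory.klDiv (μ.map (fun ω => (X ω, Y ω))) ((μ.map X).prod (μ.map Y))

/-- The coefficient `sinc (m + 2 x / lam)`, `sinc t = sin (π t) / (π t)`, with which the `m`-th
Fourier coefficient of the scene enters the noiseless reading at position `x`.
(`Real.sinc u` is `sin u / u`.) -/
def coeff (lam x : ℝ) (m : ℤ) : ℝ :=
  Real.sinc (Real.pi * ((m : ℝ) + 2 / lam * x))

variable {Ω : Type*}

/-- Noisy readings of the infinite model at the sensor positions in `S`. -/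
def fullReading (lam : ℝ) (β : ℤ → Ω → ℂ) (w : ℝ → Ω → ℂ) (S : Finset ℝ) (ω : Ω) :
    {x // x ∈ S} → ℂ :=
  fun x => (∑' m : ℤ, (coeff lam x.1 m : ℂ) * β m ω) + w x.1 ω

/-- Noisy readings of the model truncated to the coefficients with index in `M`. -/
def truncReading (lam : ℝ) (M : Finset ℤ) (β : ℤ → Ω → ℂ) (w : ℝ → Ω → ℂ) (S : Finset ℝ)
    (ω : Ω) : {x // x ∈ S} → ℂ :=
  fun x => (∑ m ∈ M, (coeff lam x.1 m : ℂ) * β m ω) + w x.1 ω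

/-- Information about the whole sequence of coefficients in the readings of the infinite model. -/
def fullInfo [MeasurableSpace Ω] (μ : Measure Ω) (lam : ℝ) (β : ℤ → Ω → ℂ) (w : ℝ → Ω → ℂ)
    (S : Finset ℝ) : ℝ≥0∞ :=
  mutualInfo (fullReading lam β w S) (fun ω (m : ℤ) => β m ω) μ

/-- Information about the truncated vector of coefficients in the readings of the truncated
model. -/
def truncInfo [MeasurableSpace Ω] (μ : Measure Ω) (lam : ℝ) (M : Finset ℤ) (β : ℤ → Ω → ℂ)
    (w : ℝ → Ω → ℂ) (S : Finset ℝ) : ℝ≥0∞ :=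
  mutualInfo (truncReading lam M β w S) (fun ω (m : {m // m ∈ M}) => β m.1 ω) μ

/-- `V` is a uniform grid of positions in the aperture `A` with distance `δ` between adjacent
positions, extending over all of `A`: every point of `A` is at distance less than `δ` from `V`.
When `A` is an interval this says that `V` is nonempty (or `A` is empty) and consists of all the
points of a lattice `x₀ + δ ℤ` that lie in `A`. -/
def IsUniformGrid (A : Set ℝ) (δ : ℝ) (V : Finset ℝ) : Prop :=
  ∃ (x₀ : ℝ) (K : ℕ), V = (Finset.range K).image (fun k : ℕ => x₀ + (k : ℝ) * δ) ∧
    (V : Set ℝ) ⊆ A ∧ ∀ x ∈ A, ∃ v ∈ V, |x - v| < δ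

/-- `GreedyRun G V n S`: starting from the empty set, `n` rounds of the greedy algorithm for the
set function `G` on the ground set `V` may end with `S`. A round adds an element of `V` not
selected yet that maximizes `G`; ties are broken arbitrarily. -/
inductive GreedyRun (G : Finset ℝ → ℝ) (V : Finset ℝ) : ℕ → Finset ℝ → Prop
  | zero : GreedyRun G V 0 ∅
  | step {n : ℕ} {S : Finset ℝ} {x : ℝ} : GreedyRun G V n S → x ∈ V \ S →
      (∀ y ∈ V \ S, G (insert y S) ≤ G (insert x S)) → GreedyRun G V (n + 1) (insert x S)

end

end ArrayDesign

/-!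
In units of the noise variance, the covariance matrix of the noiseless readings is the Gram matrix
`G` of vectors of `ℓ²` indexed by the positions, and the information of the linear Gaussian channel
is `log det (1 + G)`: an orthogonal rotation of the readings diagonalizes `G` without changing the
noise law, and each scalar channel contributes `log (1 + eigenvalue)`. By the chain rule, a further
position gains the logarithm of its variance given the earlier readings, the minimal cost of a
ridge regression. More readings only lower this minimum, so the information is monotone and
submodular, and the greedy algorithm reaches the fraction `1 - 1/e` of every `N`-set on the grid.

Two perturbations reduce an arbitrary set of positions to that case. Dropping the coefficients
outside `M` removes a component orthogonal to the rest, of squared norm at most `ε / v`, and costs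
at most `log (1 + N ε / v)` per reading. Moving the positions one after the other to distinct grid
points displaces each by at most `N δ`, and the Lipschitz bound on the vectors controls the loss.
For a single sensor that loss can exceed the claimed one; there the greedy choice is optimal on the
grid, and `3 / 2 * (1 - 1 / e) ≤ 1` makes up the difference.
-/

namespace ArrayDesign

open scoped RealInnerProductSpace

section Submodular

variable {ι : Type*} [DecidableEq ι]

/-- A set function is submodular if it has diminishing increments. -/
def IsSubmodular (G : Finset ι → ℝ) : Prop :=
  ∀ ⦃S T : Finset ι⦄, S ⊆ T → ∀ x ∉ T, G (insert x T) - G T ≤ G (insert x S) - G S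

variable {G : Finset ι → ℝ}

lemma IsSubmodular.union_le_add_sum (hG : IsSubmodular G) {S R : Finset ι} (hR : Disjoint R S) :
    G (S ∪ R) ≤ G S + ∑ y ∈ R, (G (insert y S) - G S) := by
  induction R using Finset.induction with
  | empty => simp
  | insert x R hx ih =>
    rw [Finset.disjoint_insert_left] at hR
    have hgain := hG (Finset.subset_union_left (s₁ := S) (s₂ := R)) x (by simp [hR.1, hx])
    rw [Finset.union_insert, Finset.sum_insert hx]
    linarith [ih hR.2]

lemma IsSubmodular.le_add_mul_of_insert_le (hG : IsSubmodular G) (hmono : Monotone G)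
    {S T : Finset ι} {N : ℕ} (hT : T.card ≤ N) {x : ι}
    (hx : ∀ y ∈ T \ S, G (insert y S) ≤ G (insert x S)) :
    G T ≤ G S + N * (G (insert x S) - G S) :=
  calc G T ≤ G (S ∪ T \ S) := hmono (by simp)
    _ ≤ G S + ∑ y ∈ T \ S, (G (insert y S) - G S) := hG.union_le_add_sum Finset.sdiff_disjoint
    _ ≤ G S + ∑ _y ∈ T \ S, (G (insert x S) - G S) := by
        gcongr with y hy
        exact hx y hy
    _ = G S + (T \ S).card * (G (insert x S) - G S) := by rw [Finset.sum_const, nsmul_eq_mul]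
    _ ≤ G S + N * (G (insert x S) - G S) := by
        gcongr
        · exact sub_nonneg.2 (hmono (Finset.subset_insert x S))
        · exact (Finset.card_le_card Finset.sdiff_subset).trans hT

end Submodular

section Greedy

variable {G : Finset ℝ → ℝ} {V S T : Finset ℝ} {n N : ℕ}

lemma GreedyRun.subset (h : GreedyRun G V n S) : S ⊆ V := by
  induction h with
  | zero => exact Finset.empty_subset V
  | step _ hx _ ih => exact Finset.insert_subset (Finset.mem_sdiff.1 hx).1 ih

lemma GreedyRun.card_eq (h : GreedyRun G V n S) : S.card = n := by
  induction h with
  | zero => rfl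
  | step _ hx _ ih => rw [Finset.card_insert_of_notMem (Finset.mem_sdiff.1 hx).2, ih]

lemma GreedyRun.le_of_one {x : ℝ} (h : GreedyRun G V 1 S) (hx : x ∈ V) : G {x} ≤ G S := by
  obtain _ | ⟨h₀, _, hmax⟩ := h
  cases h₀
  simpa using hmax x (by simpa using hx)

lemma GreedyRun.sub_le_pow_mul (h : GreedyRun G V n S) (hG : IsSubmodular G) (hmono : Monotone G)
    (hT : T ⊆ V) (hcard : T.card ≤ N) (hN : 0 < N) :
    G T - G S ≤ (1 - 1 / (N : ℝ)) ^ n * (G T - G ∅) := by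
  induction h with
  | zero => simp
  | @step n S x _ _ hmax ih =>
    have hN₁ : (1 : ℝ) ≤ N := by exact_mod_cast hN
    have hgap : G T - G S ≤ N * (G (insert x S) - G S) := sub_le_iff_le_add'.2
      (hG.le_add_mul_of_insert_le hmono hcard
        fun y hy => hmax y (Finset.sdiff_subset_sdiff hT subset_rfl hy))
    have hgain : 1 / (N : ℝ) * (G T - G S) ≤ G (insert x S) - G S := by
      rw [one_div_mul_eq_div, div_le_iff₀' (by positivity)]
      exact hgap
    calc G T - G (insert x S) ≤ (1 - 1 / (N : ℝ)) * (G T - G S) := by linarith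
      _ ≤ (1 - 1 / (N : ℝ)) * ((1 - 1 / (N : ℝ)) ^ n * (G T - G ∅)) := by
          gcongr
          rw [sub_nonneg]
          exact div_le_one_of_le₀ hN₁ (by positivity)
      _ = (1 - 1 / (N : ℝ)) ^ (n + 1) * (G T - G ∅) := by ring

lemma GreedyRun.one_sub_inv_exp_mul_le (h : GreedyRun G V N S) (hG : IsSubmodular G)
    (hmono : Monotone G) (hempty : G ∅ = 0) (hT : T ⊆ V) (hcard : T.card ≤ N) :
    (1 - 1 / Real.exp 1) * G T ≤ G S := by
  have hG₀ : 0 ≤ G T := hempty.symm.trans_le (hmono T.empty_subset)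
  obtain rfl | hN := N.eq_zero_or_pos
  · rw [Finset.card_eq_zero.1 (Nat.le_zero.1 hcard), hempty, mul_zero, ← hempty]
    exact hmono S.empty_subset
  have hpow : (1 - 1 / (N : ℝ)) ^ N ≤ 1 / Real.exp 1 := by
    rw [one_div (Real.exp 1), ← Real.exp_neg]
    exact Real.one_sub_div_pow_le_exp_neg (by exact_mod_cast hN)
  have hgap : G T - G S ≤ 1 / Real.exp 1 * G T :=
    calc G T - G S ≤ (1 - 1 / (N : ℝ)) ^ N * (G T - G ∅) :=
          h.sub_le_pow_mul hG hmono hT hcard hN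
      _ ≤ 1 / Real.exp 1 * G T := by
          rw [hempty, sub_zero]
          gcongr
  linarith

end Greedy

section LinearPrediction

lemma norm_sum_smul_sq_le {E κ : Type*} [SeminormedAddCommGroup E] [NormedSpace ℝ E] (T : Finset κ)
    (c : κ → ℝ) (b : κ → E) :
    ‖∑ i ∈ T, c i • b i‖ ^ 2 ≤ (∑ i ∈ T, c i ^ 2) * ∑ i ∈ T, ‖b i‖ ^ 2 := by
  have htriangle : ‖∑ i ∈ T, c i • b i‖ ≤ ∑ i ∈ T, |c i| * ‖b i‖ :=
    norm_sum_le_of_le _ fun i _ => by rw [norm_smul, Real.norm_eq_abs]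
  calc ‖∑ i ∈ T, c i • b i‖ ^ 2 ≤ (∑ i ∈ T, |c i| * ‖b i‖) ^ 2 := by gcongr
    _ ≤ (∑ i ∈ T, |c i| ^ 2) * ∑ i ∈ T, ‖b i‖ ^ 2 := Finset.sum_mul_sq_le_sq_mul_sq _ _ _
    _ = (∑ i ∈ T, c i ^ 2) * ∑ i ∈ T, ‖b i‖ ^ 2 := by simp only [sq_abs]

variable {H : Type*} [NormedAddCommGroup H] [InnerProductSpace ℝ H]
  {κ κ' : Type*} [Fintype κ] [Fintype κ']

/-- The error variance of the linear prediction, with coefficients `c`, of a noisy reading of `x`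
from noisy readings of the `a i`: the reading of a vector `y` has variance `‖y‖ ^ 2 + 1`, of which
`1` is due to noise that is independent between readings. -/
noncomputable def predCost (a : κ → H) (x : H) (c : κ → ℝ) : ℝ :=
  1 + ‖x - ∑ i, c i • a i‖ ^ 2 + ∑ i, c i ^ 2

/-- The least error variance of a linear prediction of a noisy reading of `x` from noisy readings
of the `a i`. -/
noncomputable def predVar (a : κ → H) (x : H) : ℝ :=
  ⨅ c, predCost a x c

lemma one_le_predCost (a : κ → H) (x : H) (c : κ → ℝ) : 1 ≤ predCost a x c := by
  rw [predCost, add_assoc]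
  exact le_add_of_nonneg_right (by positivity)

lemma predVar_le_predCost (a : κ → H) (x : H) (c : κ → ℝ) : predVar a x ≤ predCost a x c :=
  ciInf_le ⟨1, Set.forall_mem_range.2 (one_le_predCost a x)⟩ c

lemma one_le_predVar (a : κ → H) (x : H) : 1 ≤ predVar a x :=
  le_ciInf (one_le_predCost a x)

lemma predVar_pos (a : κ → H) (x : H) : 0 < predVar a x :=
  one_pos.trans_le (one_le_predVar a x)

lemma predVar_le_one_add_norm_sq (a : κ → H) (x : H) : predVar a x ≤ 1 + ‖x‖ ^ 2 := by
  simpa [predCost] using predVar_le_predCost a x 0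

lemma predVar_le_predVar_comp (a : κ' → H) (x : H) (f : κ ↪ κ') :
    predVar a x ≤ predVar (a ∘ f) x := by
  refine le_ciInf fun c => ?_
  set d : κ' → ℝ := Function.extend f c 0
  have hd : ∀ i, d (f i) = c i := f.injective.extend_apply c 0
  have hzero : ∀ j ∉ Set.range f, d j = 0 := Function.extend_apply' _ _
  have hsum : ∑ i, c i • a (f i) = ∑ j, d j • a j :=
    Fintype.sum_of_injective f f.injective _ _ (fun j hj => by rw [hzero j hj, zero_smul])
      fun i => by rw [hd]
  have hsq : ∑ i, c i ^ 2 = ∑ j, d j ^ 2 :=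
    Fintype.sum_of_injective f f.injective _ _ (fun j hj => by rw [hzero j hj, sq, zero_mul])
      fun i => by rw [hd]
  refine (predVar_le_predCost a x d).trans_eq ?_
  simp only [predCost, Function.comp_apply, hsum, hsq]

lemma posDef_one_add_gram {ι : Type*} [Finite ι] [DecidableEq ι] (a : ι → H) :
    (1 + Matrix.gram ℝ a).PosDef :=
  Matrix.PosDef.one.add_posSemidef (Matrix.posSemidef_gram ℝ a)

section NormalEquations

variable [DecidableEq κ]

lemma dotProduct_one_add_gram_mulVec (a : κ → H) (c : κ → ℝ) :
    c ⬝ᵥ (1 + Matrix.gram ℝ a).mulVec c = ∑ i, c i ^ 2 + ‖∑ i, c i • a i‖ ^ 2 := by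
  have hgram := Matrix.star_dotProduct_gram_mulVec (𝕜 := ℝ) a c c
  rw [real_inner_self_eq_norm_sq, star_trivial] at hgram
  rw [Matrix.add_mulVec, dotProduct_add, hgram, Matrix.one_mulVec]
  simp only [dotProduct, sq]

lemma predCost_eq (a : κ → H) (x : H) (c : κ → ℝ) :
    predCost a x c = 1 + ‖x‖ ^ 2 - 2 * (c ⬝ᵥ fun i => ⟪a i, x⟫) +
      c ⬝ᵥ (1 + Matrix.gram ℝ a).mulVec c := by
  have hinner : ⟪x, ∑ i, c i • a i⟫ = c ⬝ᵥ fun i => ⟪a i, x⟫ := by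
    simp only [inner_sum, inner_smul_right, dotProduct, real_inner_comm]
  rw [dotProduct_one_add_gram_mulVec, predCost, norm_sub_sq_real, hinner]
  ring

lemma predVar_eq_predCost_of_mulVec_eq {a : κ → H} {x : H} {c : κ → ℝ}
    (hc : (1 + Matrix.gram ℝ a).mulVec c = fun i => ⟪a i, x⟫) : predVar a x = predCost a x c := by
  refine le_antisymm (predVar_le_predCost a x c) (le_ciInf fun d => ?_)
  have hK := posDef_one_add_gram a
  have hsymm : c ⬝ᵥ (1 + Matrix.gram ℝ a).mulVec d = d ⬝ᵥ (1 + Matrix.gram ℝ a).mulVec c := by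
    rw [Matrix.dotProduct_mulVec, ← Matrix.mulVec_transpose, dotProduct_comm,
      ← Matrix.conjTranspose_eq_transpose_of_trivial, hK.isHermitian.eq]
  have hsquare := hK.posSemidef.dotProduct_mulVec_nonneg (d - c)
  rw [star_trivial, Matrix.mulVec_sub, dotProduct_sub, sub_dotProduct, sub_dotProduct, hsymm,
    hc] at hsquare
  rw [predCost_eq, predCost_eq, hc]
  linarith

lemma one_add_gram_mulVec_inv_mulVec (a : κ → H) (k : κ → ℝ) :
    (1 + Matrix.gram ℝ a).mulVec ((1 + Matrix.gram ℝ a)⁻¹.mulVec k) = k := by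
  rw [Matrix.mulVec_mulVec, Matrix.mul_nonsing_inv _ (posDef_one_add_gram a).det_pos.ne'.isUnit,
    Matrix.one_mulVec]

lemma predVar_eq_sub (a : κ → H) (x : H) :
    predVar a x = 1 + ‖x‖ ^ 2 -
      (fun i => ⟪a i, x⟫) ⬝ᵥ (1 + Matrix.gram ℝ a)⁻¹.mulVec fun i => ⟪a i, x⟫ := by
  have hc := one_add_gram_mulVec_inv_mulVec a fun i => ⟪a i, x⟫
  rw [predVar_eq_predCost_of_mulVec_eq hc, predCost_eq, hc, dotProduct_comm]
  ring

end NormalEquations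

lemma exists_predCost_eq_predVar (a : κ → H) (x : H) : ∃ c, predCost a x c = predVar a x := by
  classical
  exact ⟨_, (predVar_eq_predCost_of_mulVec_eq
    (one_add_gram_mulVec_inv_mulVec a fun i => ⟪a i, x⟫)).symm⟩

lemma sqrt_predVar_sub_one_le (a : κ → H) (x y : H) :
    √(predVar a x - 1) ≤ √(predVar a y - 1) + ‖x - y‖ := by
  obtain ⟨c, hc⟩ := exists_predCost_eq_predVar a y
  have hy : predVar a y - 1 = ‖y - ∑ i, c i • a i‖ ^ 2 + ∑ i, c i ^ 2 := by
    rw [← hc, predCost]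
    ring
  have hnorm : ‖y - ∑ i, c i • a i‖ ≤ √(predVar a y - 1) :=
    Real.le_sqrt_of_sq_le (by rw [hy]; exact le_add_of_nonneg_right (by positivity))
  have htriangle : ‖x - ∑ i, c i • a i‖ ^ 2 ≤ (‖y - ∑ i, c i • a i‖ + ‖x - y‖) ^ 2 := by
    gcongr
    rw [add_comm]
    exact norm_sub_le_norm_sub_add_norm_sub x y _
  refine Real.sqrt_le_iff.2 ⟨by positivity, ?_⟩
  calc predVar a x - 1
      ≤ ‖x - ∑ i, c i • a i‖ ^ 2 + ∑ i, c i ^ 2 := by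
        linarith [predVar_le_predCost a x c, predCost.eq_1 a x c]
    _ ≤ (‖y - ∑ i, c i • a i‖ + ‖x - y‖) ^ 2 + ∑ i, c i ^ 2 := by gcongr
    _ = (predVar a y - 1) + 2 * ‖y - ∑ i, c i • a i‖ * ‖x - y‖ + ‖x - y‖ ^ 2 := by rw [hy]; ring
    _ ≤ √(predVar a y - 1) ^ 2 + 2 * √(predVar a y - 1) * ‖x - y‖ + ‖x - y‖ ^ 2 := by
        rw [Real.sq_sqrt (sub_nonneg.2 (one_le_predVar a y))]
        gcongr
    _ = (√(predVar a y - 1) + ‖x - y‖) ^ 2 := by ring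

lemma predVar_le_mul_of_norm_sub_le (a : κ → H) {x y : H} {B Δ : ℝ} (hx : ‖x‖ ≤ B) (hy : ‖y‖ ≤ B)
    (hxy : ‖x - y‖ ≤ Δ) : predVar a x ≤ predVar a y * (1 + 2 * B * Δ) := by
  have hB : 0 ≤ B := (norm_nonneg x).trans hx
  have hΔ : 0 ≤ Δ := (norm_nonneg _).trans hxy
  have hbound : ∀ {z : H}, ‖z‖ ≤ B → √(predVar a z - 1) ≤ B := fun {z} hz =>
    Real.sqrt_le_iff.2 ⟨hB, by
      have := pow_le_pow_left₀ (norm_nonneg z) hz 2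
      linarith [predVar_le_one_add_norm_sq a z]⟩
  have hlip : √(predVar a x - 1) - √(predVar a y - 1) ≤ Δ := by
    linarith [sqrt_predVar_sub_one_le a x y]
  have hsub : predVar a x - predVar a y ≤ 2 * B * Δ :=
    calc predVar a x - predVar a y
        = √(predVar a x - 1) ^ 2 - √(predVar a y - 1) ^ 2 := by
          rw [Real.sq_sqrt (sub_nonneg.2 (one_le_predVar a x)),
            Real.sq_sqrt (sub_nonneg.2 (one_le_predVar a y))]
          ring
      _ = (√(predVar a x - 1) + √(predVar a y - 1)) *
            (√(predVar a x - 1) - √(predVar a y - 1)) := by ring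
      _ ≤ (√(predVar a x - 1) + √(predVar a y - 1)) * Δ := by gcongr
      _ ≤ (B + B) * Δ := by
          gcongr
          · exact hbound hx
          · exact hbound hy
      _ = 2 * B * Δ := by ring
  nlinarith [one_le_predVar a y, mul_nonneg hB hΔ]

lemma predVar_add_le_mul_of_orthogonal {a b : κ → H} {x y : H} (hay : ∀ i, ⟪a i, y⟫ = 0)
    (hxb : ∀ i, ⟪x, b i⟫ = 0) (hab : ∀ i j, ⟪a i, b j⟫ = 0) (hxy : ⟪x, y⟫ = 0) :
    predVar (a + b) (x + y) ≤ predVar a x * (1 + (‖y‖ ^ 2 + ∑ i, ‖b i‖ ^ 2)) := by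
  obtain ⟨c, hc⟩ := exists_predCost_eq_predVar a x
  have hsplit : x + y - ∑ i, c i • (a + b) i =
      (x - ∑ i, c i • a i) + (y - ∑ i, c i • b i) := by
    simp only [Pi.add_apply, smul_add, Finset.sum_add_distrib]
    abel
  have horth : ⟪x - ∑ i, c i • a i, y - ∑ i, c i • b i⟫ = 0 := by
    simp [inner_sub_left, inner_sub_right, inner_sum, sum_inner, inner_smul_left,
      inner_smul_right, hab, hay, hxb, hxy]
  have hperturb : ‖y - ∑ i, c i • b i‖ ^ 2 ≤
      (1 + ∑ i, c i ^ 2) * (‖y‖ ^ 2 + ∑ i, ‖b i‖ ^ 2) := by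
    simpa [Fintype.sum_option, sub_eq_add_neg] using
      norm_sum_smul_sq_le Finset.univ (fun o : Option κ => o.elim 1 (-c)) (fun o => o.elim y b)
  have hcoeff : 1 + ∑ i, c i ^ 2 ≤ predVar a x := by
    rw [← hc, predCost]
    linarith [sq_nonneg ‖x - ∑ i, c i • a i‖]
  calc predVar (a + b) (x + y)
      ≤ predCost (a + b) (x + y) c := predVar_le_predCost _ _ _
    _ = predVar a x + ‖y - ∑ i, c i • b i‖ ^ 2 := by
        rw [← hc, predCost, hsplit, norm_add_sq_real, horth, predCost]
        ring
    _ ≤ predVar a x + predVar a x * (‖y‖ ^ 2 + ∑ i, ‖b i‖ ^ 2) := by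
        gcongr
        exact hperturb.trans (by gcongr)
    _ = predVar a x * (1 + (‖y‖ ^ 2 + ∑ i, ‖b i‖ ^ 2)) := by ring

end LinearPrediction

section GaussInfo

variable {H : Type*} [NormedAddCommGroup H] [InnerProductSpace ℝ H]
  {κ κ' : Type*} [Fintype κ] [DecidableEq κ] [Fintype κ'] [DecidableEq κ']

/-- The information, in nats, about a white complex Gaussian signal in unit-noise readings of the
vectors `a i`, whose covariance matrix is `1 + Matrix.gram ℝ a`. -/
noncomputable def gaussInfo (a : κ → H) : ℝ :=
  Real.log (1 + Matrix.gram ℝ a).det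

lemma gaussInfo_comp_equiv (a : κ → H) (e : κ' ≃ κ) : gaussInfo (a ∘ e) = gaussInfo a := by
  have hsubmatrix : 1 + Matrix.gram ℝ (a ∘ e) = (1 + Matrix.gram ℝ a).submatrix e e := by
    ext i j
    simp [Matrix.gram_apply, Matrix.one_apply]
  rw [gaussInfo, hsubmatrix, Matrix.det_submatrix_equiv_self, gaussInfo]

lemma det_one_add_gram_option (a : Option κ → H) :
    (1 + Matrix.gram ℝ a).det =
      (1 + Matrix.gram ℝ (a ∘ some)).det * predVar (a ∘ some) (a none) := by
  let K : Matrix κ κ ℝ := 1 + Matrix.gram ℝ (a ∘ some)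
  let k : κ → ℝ := fun i => ⟪a (some i), a none⟫
  have : Invertible K := (posDef_one_add_gram (a ∘ some)).isUnit.invertible
  let e : κ ⊕ Unit ≃ Option κ := (Equiv.optionEquivSumPUnit κ).symm
  have hblock : (1 + Matrix.gram ℝ a).submatrix e e =
      Matrix.fromBlocks K (Matrix.replicateCol Unit k) (Matrix.replicateRow Unit k)
        (Matrix.of fun _ _ => 1 + ‖a none‖ ^ 2) := by
    ext (i | i) (j | j) <;> simp [K, k, e, Matrix.gram_apply, Matrix.one_apply, real_inner_comm]
  have hschur : k ⬝ᵥ K⁻¹.mulVec k =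
      (Matrix.replicateRow Unit k * ⅟K * Matrix.replicateCol Unit k) default default := by
    rw [Matrix.mul_assoc, Matrix.invOf_eq_nonsing_inv]
    simp [Matrix.mul_apply, Matrix.mulVec, dotProduct]
  rw [← Matrix.det_submatrix_equiv_self e, hblock, Matrix.det_fromBlocks₁₁,
    Matrix.det_unique (n := Unit), Matrix.sub_apply, ← hschur, Matrix.of_apply, predVar_eq_sub]
  rfl

lemma gaussInfo_option (a : Option κ → H) :
    gaussInfo a = gaussInfo (a ∘ some) + Real.log (predVar (a ∘ some) (a none)) := by
  rw [gaussInfo, det_one_add_gram_option, Real.log_mul (posDef_one_add_gram _).det_pos.ne'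
    (predVar_pos _ _).ne', gaussInfo]

lemma gaussInfo_update (a : κ → H) (i : κ) (x : H) :
    gaussInfo (Function.update a i x) =
      gaussInfo (fun j : {j // j ≠ i} => a j) +
        Real.log (predVar (fun j : {j // j ≠ i} => a j) x) := by
  have hsome : (Function.update a i x ∘ Equiv.optionSubtypeNe i) ∘ some =
      fun j : {j // j ≠ i} => a j := by
    ext j
    simp [Function.update_of_ne j.2]
  rw [← gaussInfo_comp_equiv _ (Equiv.optionSubtypeNe i), gaussInfo_option, hsome]
  simp

lemma gaussInfo_update_le (a : κ → H) (i : κ) {x y : H} {B Δ : ℝ} (hx : ‖x‖ ≤ B) (hy : ‖y‖ ≤ B)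
    (hxy : ‖x - y‖ ≤ Δ) :
    gaussInfo (Function.update a i x) ≤
      gaussInfo (Function.update a i y) + Real.log (1 + 2 * B * Δ) := by
  have hB : 0 ≤ B := (norm_nonneg x).trans hx
  have hΔ : 0 ≤ Δ := (norm_nonneg _).trans hxy
  rw [gaussInfo_update, gaussInfo_update, add_assoc,
    ← Real.log_mul (predVar_pos _ _).ne' (by positivity)]
  gcongr
  · exact predVar_pos _ _
  · exact predVar_le_mul_of_norm_sub_le _ hx hy hxy

lemma gaussInfo_le_add_sum_log {x y : κ → H} {B : ℝ} {Δ : κ → ℝ} (hx : ∀ i, ‖x i‖ ≤ B)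
    (hy : ∀ i, ‖y i‖ ≤ B) (hxy : ∀ i, ‖x i - y i‖ ≤ Δ i) :
    gaussInfo x ≤ gaussInfo y + ∑ i, Real.log (1 + 2 * B * Δ i) := by
  suffices h : ∀ T : Finset κ,
      gaussInfo x ≤ gaussInfo (T.piecewise y x) + ∑ i ∈ T, Real.log (1 + 2 * B * Δ i) by
    simpa using h Finset.univ
  intro T
  induction T using Finset.induction with
  | empty => simp
  | insert i T hi ih =>
    have hupdate : T.piecewise y x = Function.update (T.piecewise y x) i (x i) := by
      rw [← Finset.piecewise_eq_of_notMem T y x hi, Function.update_eq_self]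
    have hstep := gaussInfo_update_le (T.piecewise y x) i (hx i) (hy i) (hxy i)
    rw [← hupdate] at hstep
    rw [Finset.piecewise_insert, Finset.sum_insert hi]
    linarith

variable {ι : Type*} [DecidableEq ι]

/-- The information in readings of the vectors `a i`, `i ∈ T`, as a function of the set `T`. -/
noncomputable def gaussInfoOn (a : ι → H) (T : Finset ι) : ℝ :=
  gaussInfo fun i : T => a i

lemma gaussInfoOn_univ_map (a : ι → H) (f : κ ↪ ι) :
    gaussInfoOn a (Finset.univ.map f) = gaussInfo (a ∘ f) := by
  let e : κ ≃ {i // i ∈ Finset.univ.map f} :=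
    (Equiv.ofInjective f f.injective).trans (Equiv.subtypeEquivRight fun i => by simp)
  exact (gaussInfo_comp_equiv (fun i : {i // i ∈ Finset.univ.map f} => a i) e).symm

lemma gaussInfoOn_empty (a : ι → H) : gaussInfoOn a ∅ = 0 := by
  simp [gaussInfoOn, gaussInfo]

lemma gaussInfoOn_insert (a : ι → H) {T : Finset ι} {x : ι} (hx : x ∉ T) :
    gaussInfoOn a (insert x T) =
      gaussInfoOn a T + Real.log (predVar (fun i : T => a i) (a x)) := by
  rw [gaussInfoOn, ← gaussInfo_comp_equiv _ (Finset.subtypeInsertEquivOption hx).symm,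
    gaussInfo_option]
  rfl

lemma gaussInfoOn_singleton (a : ι → H) (x : ι) :
    gaussInfoOn a {x} = Real.log (1 + ‖a x‖ ^ 2) := by
  rw [← insert_empty_eq, gaussInfoOn_insert a (Finset.notMem_empty x), gaussInfoOn_empty, zero_add,
    predVar_eq_sub]
  simp [dotProduct]

lemma monotone_gaussInfoOn (a : ι → H) : Monotone (gaussInfoOn a) := by
  refine Finset.monotone_iff_forall_le_cons.2 fun T x hx => ?_
  rw [Finset.cons_eq_insert, gaussInfoOn_insert a hx]
  exact le_add_of_nonneg_right (Real.log_nonneg (one_le_predVar _ _))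

lemma gaussInfoOn_nonneg (a : ι → H) (T : Finset ι) : 0 ≤ gaussInfoOn a T :=
  (gaussInfoOn_empty a).symm.trans_le (monotone_gaussInfoOn a T.empty_subset)

lemma isSubmodular_gaussInfoOn (a : ι → H) : IsSubmodular (gaussInfoOn a) := by
  intro S T hST x hx
  rw [gaussInfoOn_insert a hx, gaussInfoOn_insert a fun h => hx (hST h), add_sub_cancel_left,
    add_sub_cancel_left]
  exact Real.log_le_log (predVar_pos _ _)
    (predVar_le_predVar_comp (fun i : T => a i) (a x) (Subtype.impEmbedding _ _ fun _ h => hST h))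

lemma gaussInfoOn_add_orthogonal_le {a b : ι → H} (hab : ∀ i j, ⟪a i, b j⟫ = 0) {ε : ℝ}
    (hb : ∀ i, ‖b i‖ ^ 2 ≤ ε) {N : ℕ} {T : Finset ι} (hT : T.card ≤ N) :
    gaussInfoOn (a + b) T ≤ gaussInfoOn a T + T.card * Real.log (1 + N * ε) := by
  induction T using Finset.induction with
  | empty => simp [gaussInfoOn_empty]
  | insert x T hx ih =>
    rw [Finset.card_insert_of_notMem hx] at hT ⊢
    have hε : 0 ≤ ε := (sq_nonneg _).trans (hb x)
    have hpower : ‖b x‖ ^ 2 + ∑ i : T, ‖b i‖ ^ 2 ≤ N * ε :=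
      calc ‖b x‖ ^ 2 + ∑ i : T, ‖b i‖ ^ 2
          ≤ ε + ∑ _i : T, ε := add_le_add (hb x) (Finset.sum_le_sum fun i _ => hb i)
        _ = (T.card + 1 : ℕ) * ε := by simp; ring
        _ ≤ N * ε := by gcongr
    have hstep : predVar (fun i : T => (a + b) i) ((a + b) x) ≤
        predVar (fun i : T => a i) (a x) * (1 + N * ε) :=
      (predVar_add_le_mul_of_orthogonal (a := fun i : T => a i) (b := fun i : T => b i)
        (fun i => hab i x) (fun i => hab x i) (fun i j => hab i j) (hab x x)).trans
          (mul_le_mul_of_nonneg_left (by linarith) (predVar_pos _ _).le)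
    have hlog := Real.log_le_log (predVar_pos _ _) hstep
    rw [Real.log_mul (predVar_pos _ _).ne' (by positivity)] at hlog
    rw [gaussInfoOn_insert _ hx, gaussInfoOn_insert _ hx]
    push_cast
    linarith [ih (by lia)]

end GaussInfo

section Grid

lemma exists_lt_notMem_near {α : Type*} {f : ℕ → α} (hf : f.Injective)
    {U : Finset α} {k K : ℕ} (hk : k < K) (hU : U.card < K) :
    ∃ i < K, f i ∉ U ∧ i ≤ k + U.card ∧ k ≤ i + U.card := by
  classical
  obtain ⟨b, hbk, hkb, hbK⟩ : ∃ b, b ≤ k ∧ k ≤ b + U.card ∧ b + U.card < K :=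
    ⟨min k (K - 1 - U.card), by lia, by lia, by lia⟩
  obtain ⟨y, hy, hyU⟩ := Finset.exists_mem_notMem_of_card_lt_card
    (s := U) (t := (Finset.Icc b (b + U.card)).image f)
    (by rw [Finset.card_image_of_injective _ hf, Nat.card_Icc]; lia)
  obtain ⟨i, hi, rfl⟩ := Finset.mem_image.1 hy
  rw [Finset.mem_Icc] at hi
  exact ⟨i, by lia, hyU, by lia, by lia⟩

variable {A : Set ℝ} {δ : ℝ} {V : Finset ℝ}

lemma IsUniformGrid.exists_notMem_near (hV : IsUniformGrid A δ V) (hδ : 0 < δ) {U : Finset ℝ}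
    (hU : U.card < V.card) {x : ℝ} (hx : x ∈ A) :
    ∃ y ∈ V, y ∉ U ∧ |x - y| ≤ (U.card + 1) * δ := by
  obtain ⟨x₀, K, rfl, -, hnear⟩ := hV
  obtain ⟨_, hz, hxz⟩ := hnear x hx
  obtain ⟨k, hk, rfl⟩ := Finset.mem_image.1 hz
  have hinj : Function.Injective fun k : ℕ => x₀ + (k : ℝ) * δ := fun i j hij => by
    simpa [hδ.ne'] using hij
  rw [Finset.card_image_of_injective _ hinj, Finset.card_range] at hU
  obtain ⟨i, hi, hiU, hik, hki⟩ := exists_lt_notMem_near hinj (Finset.mem_range.1 hk) hU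
  refine ⟨_, Finset.mem_image_of_mem _ (Finset.mem_range.2 hi), hiU, ?_⟩
  have hindex : |(k : ℝ) - i| ≤ U.card := by
    rw [abs_sub_le_iff, sub_le_iff_le_add', sub_le_iff_le_add']
    exact ⟨by exact_mod_cast hki, by exact_mod_cast hik⟩
  calc |x - (x₀ + i * δ)| ≤ |x - (x₀ + k * δ)| + |x₀ + k * δ - (x₀ + i * δ)| := abs_sub_le _ _ _
    _ = |x - (x₀ + k * δ)| + |(k : ℝ) - i| * δ := by
        rw [add_sub_add_left_eq_sub, ← sub_mul, abs_mul, abs_of_pos hδ]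
    _ ≤ δ + U.card * δ := by gcongr
    _ = (U.card + 1) * δ := by ring

lemma IsUniformGrid.exists_embedding_near (hV : IsUniformGrid A δ V) (hδ : 0 < δ) {n : ℕ}
    (hn : n ≤ V.card) {p : Fin n → ℝ} (hp : ∀ i, p i ∈ A) :
    ∃ g : Fin n ↪ ℝ, (∀ i, g i ∈ V) ∧ ∀ i, |p i - g i| ≤ (i + 1) * δ := by
  induction n with
  | zero => exact ⟨Function.Embedding.ofIsEmpty, fun i => i.elim0, fun i => i.elim0⟩
  | succ n ih =>
    obtain ⟨g, hgV, hpg⟩ := ih (Nat.le_of_succ_le hn) (p := p ∘ Fin.castSucc) fun i => hp _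
    have hcard : (Finset.univ.map g).card = n := by simp
    obtain ⟨y, hyV, hy, hpy⟩ := hV.exists_notMem_near hδ (U := Finset.univ.map g)
      (by lia) (hp (Fin.last n))
    refine ⟨Fin.Embedding.snoc g (a := y) (by simpa using hy),
      Fin.lastCases ?_ fun i => ?_, Fin.lastCases ?_ fun i => ?_⟩
    · simpa using hyV
    · simpa using hgV i
    · simpa [hcard] using hpy
    · simpa using hpg i

/-- By concavity of the logarithm. -/
lemma sum_log_one_add_mul_le {r : ℝ} (hr : 0 ≤ r) (n : ℕ) :
    ∑ i : Fin n, Real.log (1 + r * (i + 1)) ≤ n * Real.log (1 + r * ((n + 1) / 2)) := by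
  have hmean : ∑ i : Fin n, (1 + r * ((i : ℝ) + 1)) = n * (1 + r * ((n + 1) / 2)) := by
    rw [Fin.sum_univ_eq_sum_range fun i => 1 + r * ((i : ℝ) + 1)]
    induction n with
    | zero => simp
    | succ n ih => rw [Finset.sum_range_succ, ih]; push_cast; ring
  set m : ℝ := 1 + r * ((n + 1) / 2)
  have hm : 0 < m := by positivity
  have htangent : ∀ i : Fin n, Real.log (1 + r * (i + 1)) ≤
      Real.log m + ((1 + r * (i + 1)) / m - 1) := fun i => by
    have hlog := Real.log_le_sub_one_of_pos (x := (1 + r * (i + 1)) / m) (by positivity)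
    rw [Real.log_div (by positivity) hm.ne'] at hlog
    linarith
  refine (Finset.sum_le_sum fun i _ => htangent i).trans_eq ?_
  rw [Finset.sum_add_distrib, Finset.sum_sub_distrib, ← Finset.sum_div, hmean]
  simp [hm.ne']

variable {H : Type*} [NormedAddCommGroup H] [InnerProductSpace ℝ H]

lemma IsUniformGrid.exists_gaussInfoOn_le (hV : IsUniformGrid A δ V) (hδ : 0 < δ) {a : ℝ → H}
    {B L : ℝ≥0} (haB : ∀ x, ‖a x‖ ≤ B) (haL : LipschitzWith L a) {S : Finset ℝ}
    (hS : (S : Set ℝ) ⊆ A) (hcard : S.card ≤ V.card) :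
    ∃ T ⊆ V, T.card = S.card ∧ gaussInfoOn a S ≤ gaussInfoOn a T +
      S.card * Real.log (1 + B * L * δ * (S.card + 1)) := by
  let p : Fin S.card ↪ ℝ := S.equivFin.symm.toEmbedding.trans (Function.Embedding.subtype _)
  have hpS : Finset.univ.map p = S := by
    ext x
    simp only [p, Finset.mem_map, Finset.mem_univ, true_and]
    exact ⟨fun ⟨i, hi⟩ => hi ▸ (S.equivFin.symm i).2,
      fun hx => ⟨S.equivFin ⟨x, hx⟩, by simp⟩⟩
  obtain ⟨g, hgV, hpg⟩ := hV.exists_embedding_near hδ hcard (p := p)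
    fun i => hS (S.equivFin.symm i).2
  refine ⟨Finset.univ.map g, fun y hy => ?_, by simp, ?_⟩
  · obtain ⟨i, -, rfl⟩ := Finset.mem_map.1 hy
    exact hgV i
  have hdist : ∀ i, ‖a (p i) - a (g i)‖ ≤ L * ((i + 1) * δ) := fun i =>
    (haL.norm_sub_le _ _).trans (by gcongr; exact hpg i)
  calc gaussInfoOn a S = gaussInfo (a ∘ p) := by rw [← gaussInfoOn_univ_map, hpS]
    _ ≤ gaussInfo (a ∘ g) + ∑ i : Fin S.card, Real.log (1 + 2 * B * (L * ((i + 1) * δ))) :=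
        gaussInfo_le_add_sum_log (fun i => haB _) (fun i => haB _) hdist
    _ = gaussInfoOn a (Finset.univ.map g) +
          ∑ i : Fin S.card, Real.log (1 + 2 * B * L * δ * (i + 1)) := by
        rw [gaussInfoOn_univ_map]
        congr! 4
        ring
    _ ≤ gaussInfoOn a (Finset.univ.map g) +
          S.card * Real.log (1 + 2 * B * L * δ * ((S.card + 1) / 2)) := by
        gcongr
        exact sum_log_one_add_mul_le (by positivity) _
    _ = gaussInfoOn a (Finset.univ.map g) +
          S.card * Real.log (1 + B * L * δ * (S.card + 1)) := by
        congr 4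
        ring

end Grid

section GreedyOnGrid

lemma three_halves_mul_one_sub_inv_exp_le_one : 3 / 2 * (1 - 1 / Real.exp 1) ≤ 1 := by
  have hexp : 1 / 3 ≤ 1 / Real.exp 1 :=
    one_div_le_one_div_of_le (Real.exp_pos 1) Real.exp_one_lt_three.le
  linarith

lemma one_sub_inv_exp_nonneg : 0 ≤ 1 - 1 / Real.exp 1 :=
  sub_nonneg.2 (div_le_one_of_le₀ (Real.one_le_exp zero_le_one) (Real.exp_pos 1).le)

lemma log_one_add_add_mul_le {x y p : ℝ} (hx : 0 ≤ x) (hy : 0 ≤ y) (hp : 1 ≤ p) :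
    Real.log (1 + (x + p * y)) ≤ Real.log (1 + x) + p * Real.log (1 + y) := by
  have hbernoulli : 1 + p * y ≤ (1 + y) ^ p :=
    one_add_mul_self_le_rpow_one_add (by linarith) hp
  have hprod : 1 + (x + p * y) ≤ (1 + x) * (1 + y) ^ p :=
    calc 1 + (x + p * y) ≤ (1 + x) * (1 + p * y) := by
          linarith [mul_nonneg hx (mul_nonneg (zero_le_one.trans hp) hy)]
      _ ≤ (1 + x) * (1 + y) ^ p := by gcongr
  calc Real.log (1 + (x + p * y)) ≤ Real.log ((1 + x) * (1 + y) ^ p) :=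
        Real.log_le_log (by positivity) hprod
    _ = Real.log (1 + x) + p * Real.log (1 + y) := by
        rw [Real.log_mul (by positivity) (by positivity), Real.log_rpow (by positivity)]

lemma sq_le_mul_add_of_le_add_pi_div_four_mul {B c d r : ℝ} (hc : 0 ≤ c) (hcB : c ≤ B)
    (hr : 0 ≤ r) (hcd : c ≤ d + Real.pi / 4 * r) : c ^ 2 ≤ B * r + 3 / 2 * d ^ 2 := by
  set k := Real.pi / 4
  have hpi : Real.pi = 4 * k := by ring
  -- `π / 4` lies between the roots `(3 ± √3) / 6` of this polynomial.
  have hk : 6 * k ^ 2 - 6 * k + 1 ≤ 0 := by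
    nlinarith [Real.pi_gt_three, Real.pi_lt_d2]
  have hkr : k * r ≤ r := mul_le_of_le_one_left hr (by linarith [Real.pi_le_four, hpi])
  obtain hcr | hrc := le_total c r
  · nlinarith [sq_nonneg d]
  have hsq : (c - k * r) ^ 2 ≤ d ^ 2 := pow_le_pow_left₀ (by linarith) (by linarith) 2
  have hform : c ^ 2 ≤ c * r + 3 / 2 * (c - k * r) ^ 2 := by
    linarith [sq_nonneg (c + (1 - 3 * k) * r), mul_nonneg (sq_nonneg r) (neg_nonneg.2 hk)]
  linarith [mul_le_mul_of_nonneg_right hcB hr]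

lemma pi_mul_add_one_le_four_mul_rpow {N : ℕ} (hN : 2 ≤ N) :
    Real.pi * (N + 1) ≤ 4 * (N : ℝ) ^ (3 / 2 : ℝ) := by
  have hN₂ : (2 : ℝ) ≤ N := by exact_mod_cast hN
  have hrpow : (N : ℝ) ^ (3 / 2 : ℝ) = N * √N := by
    rw [show (3 / 2 : ℝ) = 1 + 1 / 2 by norm_num, Real.rpow_add (by positivity), Real.rpow_one,
      Real.sqrt_eq_rpow]
  have hsqrt : (1.4 : ℝ) ≤ √N := Real.le_sqrt_of_sq_le (by norm_num; linarith)
  calc Real.pi * (N + 1) ≤ 3.15 * (N + 1) := by gcongr; exact Real.pi_lt_d2.le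
    _ ≤ 4 * (N * 1.4) := by linarith
    _ ≤ 4 * (N : ℝ) ^ (3 / 2 : ℝ) := by rw [hrpow]; gcongr

variable {H : Type*} [NormedAddCommGroup H] [InnerProductSpace ℝ H] {a : ℝ → H} {B L : ℝ≥0}
  {A : Set ℝ} {δ : ℝ} {V S Sgr : Finset ℝ} {N : ℕ}

lemma GreedyRun.one_sub_inv_exp_mul_singleton_le (hgr : GreedyRun (gaussInfoOn a) V 1 Sgr)
    (hV : IsUniformGrid A δ V) (hδ : 0 < δ) (haB : ∀ x, ‖a x‖ ≤ B) (haL : LipschitzWith L a)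
    {x : ℝ} (hx : x ∈ A) :
    (1 - 1 / Real.exp 1) * (gaussInfoOn a {x} - Real.log (1 + 4 / Real.pi * B * L * δ)) ≤
      gaussInfoOn a Sgr := by
  have hcard : 1 ≤ V.card := hgr.card_eq ▸ Finset.card_le_card hgr.subset
  obtain ⟨y, hyV, -, hxy⟩ := hV.exists_notMem_near hδ (U := ∅) (by simpa using hcard) hx
  have hnorm : ‖a x‖ ≤ ‖a y‖ + Real.pi / 4 * (4 / Real.pi * L * δ) :=
    calc ‖a x‖ ≤ ‖a y‖ + ‖a x - a y‖ := norm_le_norm_add_norm_sub' _ _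
      _ ≤ ‖a y‖ + L * δ := by
          gcongr
          exact (haL.norm_sub_le x y).trans (by gcongr; simpa using hxy)
      _ = ‖a y‖ + Real.pi / 4 * (4 / Real.pi * L * δ) := by
          field_simp
  have hsq : ‖a x‖ ^ 2 ≤ 4 / Real.pi * B * L * δ + 3 / 2 * ‖a y‖ ^ 2 :=
    (sq_le_mul_add_of_le_add_pi_div_four_mul (norm_nonneg _) (haB x) (by positivity)
      hnorm).trans_eq (by ring)
  have hlog : gaussInfoOn a {x} ≤
      Real.log (1 + 4 / Real.pi * B * L * δ) + 3 / 2 * gaussInfoOn a {y} := by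
    rw [gaussInfoOn_singleton, gaussInfoOn_singleton]
    exact (Real.log_le_log (by positivity) (by gcongr)).trans
      (log_one_add_add_mul_le (by positivity) (by positivity) (by norm_num))
  calc (1 - 1 / Real.exp 1) * (gaussInfoOn a {x} - Real.log (1 + 4 / Real.pi * B * L * δ))
      ≤ (1 - 1 / Real.exp 1) * (3 / 2 * gaussInfoOn a {y}) :=
        mul_le_mul_of_nonneg_left (sub_le_iff_le_add'.2 hlog) one_sub_inv_exp_nonneg
    _ = 3 / 2 * (1 - 1 / Real.exp 1) * gaussInfoOn a {y} := by ring
    _ ≤ gaussInfoOn a {y} :=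
        mul_le_of_le_one_left (gaussInfoOn_nonneg a _) three_halves_mul_one_sub_inv_exp_le_one
    _ ≤ gaussInfoOn a Sgr := hgr.le_of_one hyV

lemma GreedyRun.one_sub_inv_exp_mul_gaussInfoOn_le_of_two_le
    (hgr : GreedyRun (gaussInfoOn a) V N Sgr) (hN : 2 ≤ N) (hV : IsUniformGrid A δ V) (hδ : 0 < δ)
    (haB : ∀ x, ‖a x‖ ≤ B) (haL : LipschitzWith L a) (hS : (S : Set ℝ) ⊆ A) (hcard : S.card ≤ N) :
    (1 - 1 / Real.exp 1) * (gaussInfoOn a S -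
        N * Real.log (1 + 4 / Real.pi * B * L * δ * (N : ℝ) ^ (3 / 2 : ℝ))) ≤
      gaussInfoOn a Sgr := by
  have hNV : N ≤ V.card := hgr.card_eq ▸ Finset.card_le_card hgr.subset
  obtain ⟨T, hTV, hT, hST⟩ := hV.exists_gaussInfoOn_le hδ haB haL hS (hcard.trans hNV)
  have hscale : (S.card : ℝ) + 1 ≤ 4 / Real.pi * (N : ℝ) ^ (3 / 2 : ℝ) := by
    rw [div_mul_eq_mul_div, le_div_iff₀' Real.pi_pos]
    refine le_trans ?_ (pi_mul_add_one_le_four_mul_rpow hN)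
    gcongr
  have hloss : S.card * Real.log (1 + B * L * δ * (S.card + 1)) ≤
      N * Real.log (1 + 4 / Real.pi * B * L * δ * (N : ℝ) ^ (3 / 2 : ℝ)) :=
    calc S.card * Real.log (1 + B * L * δ * (S.card + 1))
        ≤ N * Real.log (1 + B * L * δ * (4 / Real.pi * (N : ℝ) ^ (3 / 2 : ℝ))) := by
          gcongr
          exact Real.log_nonneg (le_add_of_nonneg_right (by positivity))
      _ = N * Real.log (1 + 4 / Real.pi * B * L * δ * (N : ℝ) ^ (3 / 2 : ℝ)) := by
          congr 3
          ring
  calc _ ≤ (1 - 1 / Real.exp 1) * gaussInfoOn a T :=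
        mul_le_mul_of_nonneg_left (by linarith) one_sub_inv_exp_nonneg
    _ ≤ gaussInfoOn a Sgr :=
        hgr.one_sub_inv_exp_mul_le (isSubmodular_gaussInfoOn a) (monotone_gaussInfoOn a)
          (gaussInfoOn_empty a) hTV (hT.trans_le hcard)

lemma GreedyRun.one_sub_inv_exp_mul_gaussInfoOn_le (hgr : GreedyRun (gaussInfoOn a) V N Sgr)
    (hV : IsUniformGrid A δ V) (hδ : 0 < δ) (haB : ∀ x, ‖a x‖ ≤ B) (haL : LipschitzWith L a)
    (hS : (S : Set ℝ) ⊆ A) (hcard : S.card ≤ N) :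
    (1 - 1 / Real.exp 1) * (gaussInfoOn a S -
        N * Real.log (1 + 4 / Real.pi * B * L * δ * (N : ℝ) ^ (3 / 2 : ℝ))) ≤
      gaussInfoOn a Sgr := by
  obtain rfl | hne := S.eq_empty_or_nonempty
  · have hlog : 0 ≤ Real.log (1 + 4 / Real.pi * B * L * δ * (N : ℝ) ^ (3 / 2 : ℝ)) :=
      Real.log_nonneg (le_add_of_nonneg_right (by positivity))
    rw [gaussInfoOn_empty, zero_sub]
    exact (mul_nonpos_of_nonneg_of_nonpos one_sub_inv_exp_nonneg
      (neg_nonpos.2 (by positivity))).trans (gaussInfoOn_nonneg a Sgr)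
  obtain rfl | hN := eq_or_lt_of_le (show 1 ≤ N from hne.card_pos.trans_le hcard)
  · obtain ⟨x, rfl⟩ := Finset.card_eq_one.1 (hcard.antisymm hne.card_pos)
    simpa using hgr.one_sub_inv_exp_mul_singleton_le hV hδ haB haL (hS (by simp))
  · exact hgr.one_sub_inv_exp_mul_gaussInfoOn_le_of_two_le hN hV hδ haB haL hS hcard

end GreedyOnGrid

section Sinc

lemma sinc_eq_integral (u : ℝ) : Real.sinc u = ∫ t in (0 : ℝ)..1, Real.cos (t * u) := by
  obtain rfl | hu := eq_or_ne u 0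
  · simp
  · rw [intervalIntegral.integral_comp_mul_right (fun t => Real.cos t) hu]
    simp [Real.sinc_of_ne_zero hu, div_eq_inv_mul]

lemma abs_sinc_sub_sinc_le (u v : ℝ) : |Real.sinc u - Real.sinc v| ≤ 1 / 2 * |u - v| := by
  have hcos : ∀ t ∈ Set.Ioc (0 : ℝ) 1, ‖Real.cos (t * u) - Real.cos (t * v)‖ ≤ t * |u - v| := by
    intro t ht
    simpa only [← mul_sub, abs_mul, abs_of_pos ht.1, Real.norm_eq_abs] using
      Real.abs_cos_sub_cos_le (t * u) (t * v)
  calc |Real.sinc u - Real.sinc v|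
      = ‖∫ t in (0 : ℝ)..1, (Real.cos (t * u) - Real.cos (t * v))‖ := by
        rw [sinc_eq_integral, sinc_eq_integral, ← intervalIntegral.integral_sub
          (Continuous.intervalIntegrable (by fun_prop) _ _)
          (Continuous.intervalIntegrable (by fun_prop) _ _), Real.norm_eq_abs]
    _ ≤ ∫ t in (0 : ℝ)..1, t * |u - v| :=
        intervalIntegral.norm_integral_le_of_norm_le zero_le_one (.of_forall hcos)
          (Continuous.intervalIntegrable (by fun_prop) _ _)
    _ = 1 / 2 * |u - v| := by
        rw [intervalIntegral.integral_mul_const, integral_id]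
        norm_num

lemma abs_coeff_le_one (lam x : ℝ) (m : ℤ) : |coeff lam x m| ≤ 1 := Real.abs_sinc_le_one _

lemma abs_coeff_sub_coeff_le {lam : ℝ} (hlam : 0 < lam) (x y : ℝ) (m : ℤ) :
    |coeff lam x m - coeff lam y m| ≤ Real.pi / lam * |x - y| := by
  have harg : Real.pi * ((m : ℝ) + 2 / lam * x) - Real.pi * ((m : ℝ) + 2 / lam * y) =
      Real.pi * (2 / lam) * (x - y) := by ring
  refine (abs_sinc_sub_sinc_le _ _).trans_eq ?_
  rw [harg, abs_mul, abs_of_pos (by positivity)]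
  ring

lemma summable_coeff_sq (lam x : ℝ) : Summable fun m : ℤ => coeff lam x m ^ 2 := by
  have hsum := (Real.summable_one_div_int_add_rpow (2 / lam * x) 2).2 one_lt_two
  refine hsum.of_norm_bounded_eventually ?_
  -- The bound fails at the at most one `m` with `m + 2 x / lam = 0`, where division gives `0`.
  have hfin : {m : ℤ | (m : ℝ) + 2 / lam * x = 0}.Finite :=
    Set.Subsingleton.finite fun m hm n hn => by
      simpa using (add_right_cancel (hm.trans hn.symm) : (m : ℝ) = n)
  filter_upwards [hfin.compl_mem_cofinite] with m hm
  have hm' : (m : ℝ) + 2 / lam * x ≠ 0 := hm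
  have hpi : 1 ≤ Real.pi ^ 2 := one_le_pow₀ (by linarith [Real.pi_gt_three])
  rw [coeff, Real.sinc_of_ne_zero (mul_ne_zero Real.pi_ne_zero hm'), Real.rpow_two, sq_abs,
    Real.norm_of_nonneg (sq_nonneg _), div_pow, mul_pow]
  exact div_le_div₀ zero_le_one (Real.sin_sq_le_one _) (by positivity)
    (le_mul_of_one_le_left (sq_nonneg _) hpi)

end Sinc

section SceneVec

variable {ρ : ℤ → ℝ≥0}

lemma mul_sq_le_mul_sq_of_abs_le {a c b : ℝ} (ha : 0 ≤ a) (hc : |c| ≤ b) :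
    a * c ^ 2 ≤ a * b ^ 2 :=
  mul_le_mul_of_nonneg_left (sq_le_sq' (neg_le_of_abs_le hc) (le_of_abs_le hc)) ha

lemma summable_mul_sq_of_abs_le (hρ : Summable ρ) {c : ℤ → ℝ} {b : ℝ}
    (hc : ∀ m, |c m| ≤ b) : Summable fun m => (ρ m : ℝ) * c m ^ 2 :=
  ((NNReal.summable_coe.2 hρ).mul_right (b ^ 2)).of_nonneg_of_le (fun _ => by positivity)
    fun m => mul_sq_le_mul_sq_of_abs_le (ρ m).coe_nonneg (hc m)

/-- The coefficients at position `x`, weighted by the square roots of `ρ`, as an element of `ℓ²`.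
When `ρ m` is the signal-to-noise ratio of the `m`-th coefficient, inner products of these vectors
are the covariances of the noiseless readings in units of the noise variance. -/
noncomputable def sceneVec (lam : ℝ) (hρ : Summable ρ) (x : ℝ) : lp (fun _ : ℤ => ℝ) 2 :=
  ⟨fun m => √(ρ m) * coeff lam x m, memℓp_gen <| by
    refine (summable_mul_sq_of_abs_le hρ (abs_coeff_le_one lam x)).congr fun m => ?_
    rw [ENNReal.toReal_ofNat, Real.rpow_two, Real.norm_eq_abs, sq_abs, mul_pow,
      Real.sq_sqrt (ρ m).coe_nonneg]⟩

lemma sceneVec_apply (lam : ℝ) (hρ : Summable ρ) (x : ℝ) (m : ℤ) :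
    sceneVec lam hρ x m = √(ρ m) * coeff lam x m := rfl

lemma hasSum_inner_sceneVec (lam : ℝ) (hρ : Summable ρ) (x y : ℝ) :
    HasSum (fun m => (ρ m : ℝ) * (coeff lam x m * coeff lam y m))
      ⟪sceneVec lam hρ x, sceneVec lam hρ y⟫ := by
  refine (lp.hasSum_inner (𝕜 := ℝ) (sceneVec lam hρ x) (sceneVec lam hρ y)).congr_fun fun m => ?_
  simp only [sceneVec_apply, RCLike.inner_apply, conj_trivial]
  rw [mul_mul_mul_comm, Real.mul_self_sqrt (ρ m).coe_nonneg, mul_comm (coeff lam y m)]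

lemma norm_le_of_abs_le (hρ : Summable ρ) {c : ℤ → ℝ} {b : ℝ} (hb : 0 ≤ b)
    (hc : ∀ m, |c m| ≤ b) {f : lp (fun _ : ℤ => ℝ) 2} (hf : ∀ m, f m = √(ρ m) * c m) :
    ‖f‖ ≤ NNReal.sqrt (∑' m, ρ m) * b := by
  have hsq : ∀ m, ⟪f m, f m⟫ = ρ m * c m ^ 2 := fun m => by
    rw [hf, real_inner_self_eq_norm_sq, Real.norm_eq_abs, sq_abs, mul_pow,
      Real.sq_sqrt (ρ m).coe_nonneg]
  refine abs_le_of_sq_le_sq' ?_ (by positivity) |>.2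
  rw [mul_pow, Real.coe_sqrt, Real.sq_sqrt (NNReal.coe_nonneg _), NNReal.coe_tsum,
    ← real_inner_self_eq_norm_sq, lp.inner_eq_tsum, ← tsum_mul_right]
  simp_rw [hsq]
  exact (summable_mul_sq_of_abs_le hρ hc).tsum_le_tsum
    (fun m => mul_sq_le_mul_sq_of_abs_le (ρ m).coe_nonneg (hc m))
    ((NNReal.summable_coe.2 hρ).mul_right (b ^ 2))

lemma norm_sceneVec_le (lam : ℝ) (hρ : Summable ρ) (x : ℝ) :
    ‖sceneVec lam hρ x‖ ≤ NNReal.sqrt (∑' m, ρ m) := by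
  simpa using norm_le_of_abs_le hρ zero_le_one (abs_coeff_le_one lam x) (sceneVec_apply lam hρ x)

lemma lipschitzWith_sceneVec {lam : ℝ} (hlam : 0 < lam) (hρ : Summable ρ) :
    LipschitzWith (NNReal.sqrt (∑' m, ρ m) * (Real.pi / lam).toNNReal) (sceneVec lam hρ) := by
  refine LipschitzWith.of_dist_le_mul fun x y => ?_
  rw [dist_eq_norm, Real.dist_eq, NNReal.coe_mul, Real.coe_toNNReal _ (by positivity), mul_assoc]
  refine norm_le_of_abs_le hρ (by positivity) (abs_coeff_sub_coeff_le hlam x y) fun m => ?_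
  rw [lp.coeFn_sub, Pi.sub_apply, sceneVec_apply, sceneVec_apply, mul_sub]

lemma sceneVec_indicator_add_compl (lam : ℝ) (hρ : Summable ρ) (M : Set ℤ) :
    sceneVec lam (NNReal.indicator_summable hρ M) + sceneVec lam (NNReal.indicator_summable hρ Mᶜ) =
      sceneVec lam hρ := by
  refine funext fun x => lp.ext (funext fun m => ?_)
  rw [Pi.add_apply, lp.coeFn_add, Pi.add_apply]
  by_cases hm : m ∈ M <;> simp [sceneVec_apply, hm]

lemma inner_sceneVec_indicator_compl (lam : ℝ) (hρ : Summable ρ) (M : Set ℤ) (x y : ℝ) :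
    ⟪sceneVec lam (NNReal.indicator_summable hρ M) x,
      sceneVec lam (NNReal.indicator_summable hρ Mᶜ) y⟫ = 0 := by
  rw [lp.inner_eq_tsum, ← tsum_zero (α := ℝ) (β := ℤ)]
  refine tsum_congr fun m => ?_
  by_cases hm : m ∈ M <;> simp [sceneVec_apply, hm]

end SceneVec

section CircularGaussian

variable {v : ℝ≥0}

lemma circularGaussian_eq_map (v : ℝ≥0) :
    circularGaussian v = ((gaussianReal 0 (v / 2)).prod (gaussianReal 0 (v / 2))).map
      Complex.measurableEquivRealProd.symm := by
  simp only [circularGaussian, ← Complex.mk_eq_add_mul_I]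
  rfl

instance isProbabilityMeasure_circularGaussian : IsProbabilityMeasure (circularGaussian v) :=
  Measure.isProbabilityMeasure_map (by fun_prop)

lemma charFun_circularGaussian (v : ℝ≥0) (z : ℂ) :
    charFun (circularGaussian v) z = Complex.exp (-(v * ‖z‖ ^ 2 / 4 : ℝ)) := by
  have hsplit : ∀ p : ℝ × ℝ,
      Complex.exp (⟪(p.1 : ℂ) + (p.2 : ℂ) * Complex.I, z⟫ * Complex.I) =
        Complex.exp (z.re * p.1 * Complex.I) * Complex.exp (z.im * p.2 * Complex.I) := by
    intro p
    rw [← Complex.exp_add, Complex.inner]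
    congr 1
    simp
    ring
  rw [charFun_apply, circularGaussian, integral_map (by fun_prop) (by fun_prop)]
  simp_rw [hsplit]
  rw [integral_prod_mul (fun x : ℝ => Complex.exp (z.re * x * Complex.I))
    (fun x : ℝ => Complex.exp (z.im * x * Complex.I)), ← charFun_apply_real, ← charFun_apply_real,
    charFun_gaussianReal, charFun_gaussianReal, ← Complex.exp_add, ← Complex.normSq_eq_norm_sq,
    Complex.normSq_apply]
  congr 1
  push_cast
  ring

lemma integrable_sq_gaussianReal (v : ℝ≥0) : Integrable (fun x : ℝ => x ^ 2) (gaussianReal 0 v) :=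
  (memLp_id_gaussianReal 2).integrable_sq

lemma integral_sq_gaussianReal (v : ℝ≥0) : ∫ x, x ^ 2 ∂(gaussianReal 0 v) = v := by
  have hvar := variance_id_gaussianReal (μ := 0) (v := v)
  rw [variance_of_integral_eq_zero aemeasurable_id (by simp)] at hvar
  simpa using hvar

lemma norm_ofReal_add_ofReal_mul_I_sq (x y : ℝ) :
    ‖(x : ℂ) + (y : ℂ) * Complex.I‖ ^ 2 = x ^ 2 + y ^ 2 := by
  rw [← Complex.normSq_eq_norm_sq, Complex.normSq_add_mul_I]

lemma integrable_norm_sq_circularGaussian (v : ℝ≥0) :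
    Integrable (fun z : ℂ => ‖z‖ ^ 2) (circularGaussian v) := by
  rw [circularGaussian, integrable_map_measure (by fun_prop) (by fun_prop)]
  simp only [Function.comp_def, norm_ofReal_add_ofReal_mul_I_sq]
  exact ((integrable_sq_gaussianReal _).comp_fst _).add ((integrable_sq_gaussianReal _).comp_snd _)

lemma integral_norm_sq_circularGaussian (v : ℝ≥0) :
    ∫ z, ‖z‖ ^ 2 ∂(circularGaussian v) = v := by
  rw [circularGaussian, integral_map (by fun_prop) (by fun_prop)]
  simp only [norm_ofReal_add_ofReal_mul_I_sq]
  rw [integral_add ((integrable_sq_gaussianReal _).comp_fst _)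
    ((integrable_sq_gaussianReal _).comp_snd _), integral_fun_fst (fun x : ℝ => x ^ 2),
    integral_fun_snd (fun x : ℝ => x ^ 2), integral_sq_gaussianReal]
  simp

/-- The density of the circular complex Gaussian law with respect to the Lebesgue measure. -/
noncomputable def circularPDF (v : ℝ≥0) (z : ℂ) : ℝ :=
  (Real.pi * v)⁻¹ * Real.exp (-‖z‖ ^ 2 / v)

lemma circularPDF_pos (hv : 0 < v) (z : ℂ) : 0 < circularPDF v z :=
  mul_pos (inv_pos.2 (mul_pos Real.pi_pos (NNReal.coe_pos.2 hv))) (Real.exp_pos _)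

@[fun_prop]
lemma measurable_circularPDF (v : ℝ≥0) : Measurable (circularPDF v) := by
  unfold circularPDF
  fun_prop

lemma log_circularPDF (hv : 0 < v) (z : ℂ) :
    Real.log (circularPDF v z) = -Real.log Real.pi - Real.log v - ‖z‖ ^ 2 / v := by
  have hv' : (0 : ℝ) < v := hv
  rw [circularPDF, Real.log_mul (by positivity) (Real.exp_pos _).ne', Real.log_exp, Real.log_inv,
    Real.log_mul Real.pi_ne_zero hv'.ne']
  ring

lemma circularPDF_ofReal_add (hv : 0 < v) (x y : ℝ) :
    circularPDF v (x + y * Complex.I) =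
      gaussianPDFReal 0 (v / 2) x * gaussianPDFReal 0 (v / 2) y := by
  have hv' : (v : ℝ) ≠ 0 := (NNReal.coe_pos.2 hv).ne'
  rw [circularPDF, norm_ofReal_add_ofReal_mul_I_sq, gaussianPDFReal, gaussianPDFReal]
  push_cast
  rw [mul_mul_mul_comm, ← Real.exp_add, ← mul_inv, Real.mul_self_sqrt (by positivity)]
  congr 2
  · ring
  · field_simp [hv']
    ring

lemma circularGaussian_eq_withDensity (hv : 0 < v) :
    circularGaussian v = volume.withDensity fun z => ENNReal.ofReal (circularPDF v z) := by
  have hv2 : v / 2 ≠ 0 := by positivity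
  refine Measure.ext_of_lintegral _ fun φ hφ => ?_
  rw [circularGaussian_eq_map, lintegral_map_equiv, gaussianReal_of_var_ne_zero _ hv2,
    prod_withDensity (measurable_gaussianPDF _ _) (measurable_gaussianPDF _ _),
    lintegral_withDensity_eq_lintegral_mul _ (by fun_prop) (by fun_prop),
    lintegral_withDensity_eq_lintegral_mul _ (by fun_prop) hφ,
    ← Complex.volume_preserving_equiv_real_prod.symm.lintegral_comp_emb
      Complex.measurableEquivRealProd.symm.measurableEmbedding]
  refine lintegral_congr fun p => ?_
  rw [Pi.mul_apply, Pi.mul_apply, Complex.measurableEquivRealProd_symm_apply,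
    Complex.mk_eq_add_mul_I, circularPDF_ofReal_add hv,
    ENNReal.ofReal_mul (gaussianPDFReal_nonneg _ _ _)]
  rfl

lemma integrable_circularPDF (hv : 0 < v) : Integrable (circularPDF v) := by
  refine ⟨(measurable_circularPDF v).aestronglyMeasurable, ?_⟩
  rw [hasFiniteIntegral_iff_ofReal (.of_forall fun z => (circularPDF_pos hv z).le),
    ← setLIntegral_univ, ← withDensity_apply _ .univ, ← circularGaussian_eq_withDensity hv]
  exact measure_lt_top _ _

end CircularGaussian

section PiWithDensity

variable {ι : Type*} [Fintype ι]

lemma pi_withDensity_ofReal {E : ι → Type*} [∀ i, MeasurableSpace (E i)]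
    (ν : ∀ i, Measure (E i)) [∀ i, SigmaFinite (ν i)] {f : ∀ i, E i → ℝ}
    (hf : ∀ i, Integrable (f i) (ν i)) (hf0 : ∀ i z, 0 ≤ f i z) :
    Measure.pi (fun i => (ν i).withDensity fun z => ENNReal.ofReal (f i z)) =
      (Measure.pi ν).withDensity fun z => ENNReal.ofReal (∏ i, f i (z i)) := by
  have hsf : ∀ i, SigmaFinite ((ν i).withDensity fun z => ENNReal.ofReal (f i z)) :=
    fun i => SigmaFinite.withDensity_ofReal _
  refine Measure.pi_eq fun s hs => ?_
  rw [withDensity_apply _ (.univ_pi hs), Measure.restrict_pi_pi,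
    ← ofReal_integral_eq_lintegral_ofReal (.fintype_prod_dep fun i => (hf i).integrableOn)
      (.of_forall fun z => Finset.prod_nonneg fun i _ => hf0 i _),
    integral_fintype_prod_eq_prod, ENNReal.ofReal_prod_of_nonneg fun i _ =>
      integral_nonneg fun z => hf0 i z]
  refine Finset.prod_congr rfl fun i _ => ?_
  rw [withDensity_apply _ (hs i), ofReal_integral_eq_lintegral_ofReal (hf i).integrableOn
    (.of_forall fun z => hf0 i z)]

lemma pi_circularGaussian_eq_withDensity {d : ι → ℝ≥0} (hd : ∀ i, 0 < d i) :
    Measure.pi (fun i => circularGaussian (d i)) =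
      volume.withDensity fun z : ι → ℂ => ENNReal.ofReal (∏ i, circularPDF (d i) (z i)) := by
  simp_rw [fun i => circularGaussian_eq_withDensity (hd i)]
  exact pi_withDensity_ofReal _ (fun i => integrable_circularPDF (hd i))
    fun i z => (circularPDF_pos (hd i) z).le

end PiWithDensity

section GaussianSeries

variable {Ω : Type*} [MeasurableSpace Ω] {μ : Measure Ω} {ι J : Type*} [Fintype ι]

lemma hasLaw_pi_circularGaussian_iff [IsProbabilityMeasure μ] {Z : Ω → ι → ℂ} {d : ι → ℝ≥0}
    (hZ : AEMeasurable Z μ) :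
    HasLaw Z (Measure.pi fun i => circularGaussian (d i)) μ ↔ ∀ ξ : ι → ℂ,
      ∫ ω, Complex.exp ((∑ i, ⟪Z ω i, ξ i⟫ : ℝ) * Complex.I) ∂μ =
        Complex.exp (-(∑ i, d i * ‖ξ i‖ ^ 2 / 4 : ℝ)) := by
  have := Measure.isProbabilityMeasure_map hZ
  have hiff : HasLaw Z (Measure.pi fun i => circularGaussian (d i)) μ ↔
      μ.map Z = Measure.pi fun i => circularGaussian (d i) :=
    ⟨HasLaw.map_eq, fun h => ⟨hZ, h⟩⟩
  rw [hiff, ← charFun_eq_pi_iff, (WithLp.equiv 2 (ι → ℂ)).forall_congr_left]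
  refine forall_congr' fun ξ => ?_
  rw [charFun_apply, AEMeasurable.map_map_of_aemeasurable (by fun_prop) hZ,
    integral_map (by fun_prop) (by fun_prop)]
  simp only [Function.comp_apply, PiLp.inner_apply, charFun_circularGaussian, ← Complex.exp_sum]
  push_cast
  rw [Finset.sum_neg_distrib]
  rfl

lemma hasLaw_add_pi_circularGaussian [IsProbabilityMeasure μ] {Z W : Ω → ι → ℂ} {d e : ι → ℝ≥0}
    (hZ : HasLaw Z (Measure.pi fun i => circularGaussian (d i)) μ)
    (hW : HasLaw W (Measure.pi fun i => circularGaussian (e i)) μ) (hZW : IndepFun Z W μ) :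
    HasLaw (Z + W) (Measure.pi fun i => circularGaussian (d i + e i)) μ := by
  have hZm := hZ.aemeasurable
  have hWm := hW.aemeasurable
  refine (hasLaw_pi_circularGaussian_iff (hZm.add hWm)).2 fun ξ => ?_
  have hexp : Continuous fun z : ι → ℂ => Complex.exp ((∑ i, ⟪z i, ξ i⟫ : ℝ) * Complex.I) := by
    have : Continuous fun z : ι → ℂ => ∑ i, ⟪z i, ξ i⟫ :=
      continuous_finsetSum _ fun i _ => (continuous_apply i).inner continuous_const
    fun_prop
  have hprod := hZW.integral_fun_comp_mul_comp hZm hWm hexp.aestronglyMeasurable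
    hexp.aestronglyMeasurable
  rw [(hasLaw_pi_circularGaussian_iff hZm).1 hZ, (hasLaw_pi_circularGaussian_iff hWm).1 hW] at hprod
  simp_rw [← Complex.exp_add, ← add_mul, ← Complex.ofReal_add, ← Finset.sum_add_distrib,
    ← inner_add_left] at hprod
  refine hprod.trans ?_
  rw [← neg_add, ← Complex.ofReal_add, ← Finset.sum_add_distrib]
  simp_rw [← add_div, ← add_mul, NNReal.coe_add]

variable {β : J → Ω → ℂ} {t : J → ℝ≥0}

lemma ae_summable_norm_sq [Countable J]
    (hβ : ∀ j, HasLaw (β j) (circularGaussian (t j)) μ) (ht : Summable t) :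
    ∀ᵐ ω ∂μ, Summable fun j => ‖β j ω‖ ^ 2 := by
  have hmeas : ∀ j, AEMeasurable (fun ω => ENNReal.ofReal (‖β j ω‖ ^ 2)) μ := fun j =>
    ((hβ j).aemeasurable.norm.pow_const 2).ennreal_ofReal
  have hmoment : ∀ j, ∫⁻ ω, ENNReal.ofReal (‖β j ω‖ ^ 2) ∂μ = t j := by
    intro j
    refine ((hβ j).lintegral_comp (f := fun z => ENNReal.ofReal (‖z‖ ^ 2)) (by fun_prop)).trans ?_
    rw [← ofReal_integral_eq_lintegral_ofReal (integrable_norm_sq_circularGaussian _)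
      (.of_forall fun z => sq_nonneg _), integral_norm_sq_circularGaussian,
      ENNReal.ofReal_coe_nnreal]
  have hfinite : ∫⁻ ω, ∑' j, ENNReal.ofReal (‖β j ω‖ ^ 2) ∂μ ≠ ∞ := by
    rw [lintegral_tsum hmeas]
    simp_rw [hmoment]
    exact ENNReal.tsum_coe_ne_top_iff_summable.2 ht
  filter_upwards [ae_lt_top' (AEMeasurable.tsum hmeas) hfinite] with ω hω
  simpa [ENNReal.toReal_ofReal] using ENNReal.summable_toReal hω.ne

lemma ae_forall_summable_mul [Countable J]
    (hβ : ∀ j, HasLaw (β j) (circularGaussian (t j)) μ) (ht : Summable t) :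
    ∀ᵐ ω ∂μ, ∀ c : J → ℝ, (Summable fun j => c j ^ 2) → Summable fun j => (c j : ℂ) * β j ω := by
  filter_upwards [ae_summable_norm_sq hβ ht] with ω hω c hc
  refine .of_norm_bounded (hc.add hω) fun j => ?_
  rw [norm_mul, Complex.norm_real, Real.norm_eq_abs]
  nlinarith [sq_nonneg (|c j| - ‖β j ω‖), sq_abs (c j), sq_nonneg (c j), sq_nonneg ‖β j ω‖]

lemma inner_ofReal_mul_left (c : ℝ) (z w : ℂ) : ⟪(c : ℂ) * z, w⟫ = c * ⟪z, w⟫ := by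
  rw [← Complex.real_smul, real_inner_smul_left]

lemma inner_ofReal_mul_right (c : ℝ) (z w : ℂ) : ⟪z, (c : ℂ) * w⟫ = c * ⟪z, w⟫ := by
  rw [← Complex.real_smul, real_inner_smul_right]

lemma hasSum_inner_sum_mul {b : ι → J → ℝ} {z : J → ℂ}
    (hz : ∀ i, Summable fun j => (b i j : ℂ) * z j) (ξ : ι → ℂ) :
    HasSum (fun j => ⟪z j, ∑ i, (b i j : ℂ) * ξ i⟫) (∑ i, ⟪∑' j, (b i j : ℂ) * z j, ξ i⟫) := by
  simp_rw [inner_sum, inner_ofReal_mul_right, ← inner_ofReal_mul_left]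
  refine hasSum_sum fun i _ => ?_
  simpa only [innerSL_apply_apply, real_inner_comm] using (hz i).hasSum.mapL (innerSL ℝ (ξ i))

lemma hasSum_mul_norm_sum_sq [DecidableEq ι] {b : ι → J → ℝ} {d : ι → ℝ}
    (hbd : ∀ i k, HasSum (fun j => t j * (b i j * b k j)) (Matrix.diagonal d i k)) (ξ : ι → ℂ) :
    HasSum (fun j => t j * ‖∑ i, (b i j : ℂ) * ξ i‖ ^ 2) (∑ i, d i * ‖ξ i‖ ^ 2) := by
  have hdiag : ∑ i, d i * ‖ξ i‖ ^ 2 = ∑ i, ∑ k, Matrix.diagonal d i k * ⟪ξ i, ξ k⟫ := by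
    refine Finset.sum_congr rfl fun i _ => ?_
    simp [Matrix.diagonal_apply, -Complex.inner]
  simp_rw [hdiag, ← real_inner_self_eq_norm_sq, sum_inner, inner_sum, inner_ofReal_mul_left,
    inner_ofReal_mul_right, Finset.mul_sum]
  refine hasSum_sum fun i _ => hasSum_sum fun k _ => ?_
  simpa only [mul_assoc] using (hbd i k).mul_right ⟪ξ i, ξ k⟫

variable [IsProbabilityMeasure μ]

lemma integral_exp_sum_inner (hβ : ∀ j, HasLaw (β j) (circularGaussian (t j)) μ)
    (hind : iIndepFun β μ) (η : J → ℂ) (F : Finset J) :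
    ∫ ω, Complex.exp ((∑ j ∈ F, ⟪β j ω, η j⟫ : ℝ) * Complex.I) ∂μ =
      Complex.exp (-(∑ j ∈ F, t j * ‖η j‖ ^ 2 / 4 : ℝ)) := by
  have hind_F : iIndepFun (fun j : F => β j) μ := hind.precomp Subtype.val_injective
  have hF := hind_F.hasLaw_pi (μ := fun j : F => circularGaussian (t j)) fun j => hβ j
  have hchar := (hasLaw_pi_circularGaussian_iff hF.aemeasurable).1 hF fun j => η j
  rw [Finset.sum_coe_sort F fun j => (t j : ℝ) * ‖η j‖ ^ 2 / 4] at hchar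
  simpa only [fun ω => Finset.sum_coe_sort F fun j => ⟪β j ω, η j⟫] using hchar

lemma tendsto_integral_exp_sum_mul_I [Countable J] {f : J → Ω → ℝ} {g : Ω → ℝ}
    (hf : ∀ j, AEMeasurable (f j) μ) (hfg : ∀ᵐ ω ∂μ, HasSum (fun j => f j ω) (g ω)) :
    Filter.Tendsto
      (fun F : Finset J => ∫ ω, Complex.exp ((∑ j ∈ F, f j ω : ℝ) * Complex.I) ∂μ)
      Filter.atTop (nhds (∫ ω, Complex.exp (g ω * Complex.I) ∂μ)) := by
  refine tendsto_integral_filter_of_dominated_convergence (fun _ => 1)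
    (.of_forall fun F => ?_)
    (.of_forall fun F => .of_forall fun ω => (Complex.norm_exp_ofReal_mul_I _).le)
    (integrable_const _) ?_
  · have hsum : AEMeasurable (fun ω => ∑ j ∈ F, f j ω) μ :=
      Finset.aemeasurable_fun_sum F fun j _ => hf j
    exact ((Complex.measurable_ofReal.comp_aemeasurable hsum).mul_const
      Complex.I).cexp.aestronglyMeasurable
  · filter_upwards [hfg] with ω hω
    exact ((by fun_prop : Continuous fun x : ℝ => Complex.exp (x * Complex.I)).tendsto _).comp hω

theorem hasLaw_tsum_mul [Countable J] [DecidableEq ι]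
    (hβ : ∀ j, HasLaw (β j) (circularGaussian (t j)) μ) (hind : iIndepFun β μ) (ht : Summable t)
    {b : ι → J → ℝ} (hb : ∀ i, Summable fun j => b i j ^ 2) {d : ι → ℝ≥0}
    (hbd : ∀ i k, HasSum (fun j => t j * (b i j * b k j))
      (Matrix.diagonal (fun i => (d i : ℝ)) i k)) :
    HasLaw (fun ω i => ∑' j, (b i j : ℂ) * β j ω) (Measure.pi fun i => circularGaussian (d i))
      μ := by
  have hmeas : ∀ j, AEMeasurable (β j) μ := fun j => (hβ j).aemeasurable
  refine (hasLaw_pi_circularGaussian_iff (aemeasurable_pi_lambda _ fun i => ?_)).2 fun ξ => ?_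
  · exact AEMeasurable.tsum fun j => (hmeas j).const_mul _
  have hsum : ∀ᵐ ω ∂μ, HasSum (fun j => ⟪β j ω, ∑ i, (b i j : ℂ) * ξ i⟫)
      (∑ i, ⟪∑' j, (b i j : ℂ) * β j ω, ξ i⟫) := by
    filter_upwards [ae_forall_summable_mul hβ ht] with ω hω
    exact hasSum_inner_sum_mul (fun i => hω _ (hb i)) ξ
  refine tendsto_nhds_unique (tendsto_integral_exp_sum_mul_I
    (fun j => (hmeas j).inner aemeasurable_const) hsum) ?_
  simp_rw [integral_exp_sum_inner hβ hind, ← Finset.sum_div]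
  have hexp : Continuous fun x : ℝ => Complex.exp (-(x / 4 : ℝ)) := by fun_prop
  exact (hexp.tendsto _).comp (hasSum_mul_norm_sum_sq hbd ξ)

end GaussianSeries

section MutualInfo

variable {Ω : Type*} [MeasurableSpace Ω] {μ : Measure Ω}
variable {α α' γ : Type*} [MeasurableSpace α] [MeasurableSpace α'] [MeasurableSpace γ]
variable {X X' : Ω → α} {Y : Ω → γ}

lemma mutualInfo_congr (h : X =ᵐ[μ] X') (Y : Ω → γ) : mutualInfo X Y μ = mutualInfo X' Y μ := by
  have hpair : (fun ω => (X ω, Y ω)) =ᵐ[μ] fun ω => (X' ω, Y ω) := h.mono fun ω hω => by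
    simp only [hω]
  rw [mutualInfo, mutualInfo, Measure.map_congr h, Measure.map_congr hpair]

variable [IsProbabilityMeasure μ]

lemma mutualInfo_comp_le (hX : AEMeasurable X μ) (hY : AEMeasurable Y μ) {g : α → α'}
    (hg : Measurable g) : mutualInfo (fun ω => g (X ω)) Y μ ≤ mutualInfo X Y μ := by
  have := Measure.isProbabilityMeasure_map hX
  have := Measure.isProbabilityMeasure_map hY
  have h := InformationTheory.klDiv_map_le (μ := μ.map fun ω => (X ω, Y ω))
    (ν := (μ.map X).prod (μ.map Y)) (hg.prodMap measurable_id)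
  rwa [AEMeasurable.map_map_of_aemeasurable (by fun_prop) (hX.prodMk hY),
    ← Measure.map_prod_map _ _ hg measurable_id, Measure.map_id,
    AEMeasurable.map_map_of_aemeasurable hg.aemeasurable hX] at h

lemma mutualInfo_comp_eq_of_leftInverse (hX : AEMeasurable X μ) (hY : AEMeasurable Y μ)
    {g : α → α'} {g' : α' → α} (hg : Measurable g) (hg' : Measurable g')
    (hinv : Function.LeftInverse g' g) :
    mutualInfo (fun ω => g (X ω)) Y μ = mutualInfo X Y μ := by
  refine (mutualInfo_comp_le hX hY hg).antisymm ?_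
  have h := mutualInfo_comp_le (hg.comp_aemeasurable hX) hY hg'
  simpa only [Function.comp_def, hinv _] using h

end MutualInfo

section GaussianChannel

lemma klDiv_eq_integral_of_eq_withDensity_exp {α : Type*} [MeasurableSpace α] {ρ ν : Measure α}
    [IsProbabilityMeasure ρ] [IsProbabilityMeasure ν] {ψ : α → ℝ} (hψ : Measurable ψ)
    (hρ : ρ = ν.withDensity fun p => ENNReal.ofReal (Real.exp (ψ p))) (hint : Integrable ψ ρ) :
    InformationTheory.klDiv ρ ν = ENNReal.ofReal (∫ p, ψ p ∂ρ) := by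
  have hac : ρ ≪ ν := hρ ▸ withDensity_absolutelyContinuous _ _
  have hllr : llr ρ ν =ᵐ[ρ] ψ := hac.ae_le <| by
    filter_upwards [hρ ▸ Measure.rnDeriv_withDensity ν hψ.exp.ennreal_ofReal] with p hp
    rw [llr, hp, ENNReal.toReal_ofReal (Real.exp_nonneg _), Real.log_exp]
  rw [InformationTheory.klDiv_of_ac_of_integrable hac (hint.congr hllr.symm),
    integral_congr_ae hllr, probReal_univ, probReal_univ, add_sub_cancel_right]

lemma map_add_prod_withDensity {γ G : Type*} [MeasurableSpace γ] [AddGroup G] [MeasurableSpace G]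
    [MeasurableAdd₂ G] [MeasurableSub₂ G] (κ : Measure γ) [SFinite κ] (ν : Measure G) [SFinite ν]
    [ν.IsAddRightInvariant] {h : γ → G} (hh : Measurable h) {q r : G → ℝ≥0∞} (hq : Measurable q)
    (hr : Measurable r) (hr_ne_zero : ∀ z, r z ≠ 0) (hr_ne_top : ∀ z, r z ≠ ∞) :
    (κ.prod (ν.withDensity q)).map (fun p => (p.2 + h p.1, p.1)) =
      ((ν.withDensity r).prod κ).withDensity fun p => q (p.1 - h p.2) / r p.1 := by
  have hshift : Measurable fun p : γ × G => (p.2 + h p.1, p.1) := by fun_prop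
  have hdens : Measurable fun p : G × γ => q (p.1 - h p.2) / r p.1 :=
    (hq.comp (by fun_prop)).div (hr.comp measurable_fst)
  refine Measure.ext_of_lintegral _ fun φ hφ => ?_
  rw [lintegral_map hφ hshift, lintegral_prod _ (by fun_prop),
    lintegral_withDensity_eq_lintegral_mul _ hdens hφ, lintegral_prod_symm' _ (hdens.mul hφ)]
  refine lintegral_congr fun y => ?_
  have hφ_noise : Measurable fun z => φ (z + h y, y) := by fun_prop
  have hφ_output : Measurable fun x => q (x - h y) / r x * φ (x, y) :=
    (hdens.mul hφ).comp measurable_prodMk_right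
  calc ∫⁻ z, φ (z + h y, y) ∂ν.withDensity q
      = ∫⁻ z, q z * φ (z + h y, y) ∂ν := lintegral_withDensity_eq_lintegral_mul _ hq hφ_noise
    _ = ∫⁻ x, q (x - h y) * φ (x - h y + h y, y) ∂ν := (lintegral_sub_right_eq_self _ (h y)).symm
    _ = ∫⁻ x, r x * (q (x - h y) / r x * φ (x, y)) ∂ν := by
        refine lintegral_congr fun x => ?_
        rw [sub_add_cancel, ← mul_assoc, ENNReal.mul_div_cancel (hr_ne_zero x) (hr_ne_top x)]
    _ = ∫⁻ x, q (x - h y) / r x * φ (x, y) ∂ν.withDensity r :=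
        (lintegral_withDensity_eq_lintegral_mul _ hr hφ_output).symm

variable {ι : Type*} [Fintype ι]

/-- The logarithm of the ratio of the densities of `∏ CN(0, e i)` at `w` and of `∏ CN(0, d i)` at
`x`. -/
noncomputable def logPDFRatio (d e : ι → ℝ≥0) (x w : ι → ℂ) : ℝ :=
  ∑ i, (Real.log (d i / e i) + (‖x i‖ ^ 2 / d i - ‖w i‖ ^ 2 / e i))

@[fun_prop]
lemma measurable_logPDFRatio {β : Type*} [MeasurableSpace β] (d e : ι → ℝ≥0) {x w : β → ι → ℂ}
    (hx : Measurable x) (hw : Measurable w) : Measurable fun b => logPDFRatio d e (x b) (w b) := by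
  unfold logPDFRatio
  fun_prop

lemma ofReal_prod_circularPDF_div {d e : ι → ℝ≥0} (hd : ∀ i, 0 < d i) (he : ∀ i, 0 < e i)
    (x w : ι → ℂ) :
    ENNReal.ofReal (∏ i, circularPDF (e i) (w i)) / ENNReal.ofReal (∏ i, circularPDF (d i) (x i)) =
      ENNReal.ofReal (Real.exp (logPDFRatio d e x w)) := by
  have hpos : ∀ i, 0 < circularPDF (e i) (w i) / circularPDF (d i) (x i) := fun i =>
    div_pos (circularPDF_pos (he i) _) (circularPDF_pos (hd i) _)
  rw [← ENNReal.ofReal_div_of_pos (Finset.prod_pos fun i _ => circularPDF_pos (hd i) _),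
    ← Finset.prod_div_distrib, ← Real.exp_log (Finset.prod_pos fun i _ => hpos i),
    Real.log_prod fun i _ => (hpos i).ne', logPDFRatio]
  congr 2
  refine Finset.sum_congr rfl fun i _ => ?_
  rw [Real.log_div (circularPDF_pos (he i) _).ne' (circularPDF_pos (hd i) _).ne',
    log_circularPDF (he i), log_circularPDF (hd i),
    Real.log_div (NNReal.coe_ne_zero.2 (hd i).ne') (NNReal.coe_ne_zero.2 (he i).ne')]
  ring

variable {Ω : Type*} [MeasurableSpace Ω] {μ : Measure Ω} {d e : ι → ℝ≥0}

lemma hasLaw_eval_pi_circularGaussian {Z : Ω → ι → ℂ}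
    (hZ : HasLaw Z (Measure.pi fun i => circularGaussian (d i)) μ) (i : ι) :
    HasLaw (fun ω => Z ω i) (circularGaussian (d i)) μ :=
  (measurePreserving_eval _ i).fun_comp_hasLaw hZ

lemma integrable_norm_sq_of_hasLaw {v : ℝ≥0} {Z : Ω → ℂ} (hZ : HasLaw Z (circularGaussian v) μ) :
    Integrable (fun ω => ‖Z ω‖ ^ 2) μ := by
  have h := integrable_norm_sq_circularGaussian v
  rw [← hZ.map_eq] at h
  exact h.comp_aemeasurable hZ.aemeasurable

lemma integral_norm_sq_of_hasLaw {v : ℝ≥0} {Z : Ω → ℂ} (hZ : HasLaw Z (circularGaussian v) μ) :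
    ∫ ω, ‖Z ω‖ ^ 2 ∂μ = v :=
  (hZ.integral_comp (f := fun z => ‖z‖ ^ 2) (by fun_prop)).trans
    (integral_norm_sq_circularGaussian v)

variable {X W : Ω → ι → ℂ} [IsProbabilityMeasure μ]

lemma integrable_logPDFRatio (hX : HasLaw X (Measure.pi fun i => circularGaussian (d i)) μ)
    (hW : HasLaw W (Measure.pi fun i => circularGaussian (e i)) μ) :
    Integrable (fun ω => logPDFRatio d e (X ω) (W ω)) μ :=
  integrable_finsetSum _ fun i _ => (integrable_const _).add <|
    ((integrable_norm_sq_of_hasLaw (hasLaw_eval_pi_circularGaussian hX i)).div_const _).sub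
      ((integrable_norm_sq_of_hasLaw (hasLaw_eval_pi_circularGaussian hW i)).div_const _)

lemma integral_logPDFRatio (hd : ∀ i, 0 < d i) (he : ∀ i, 0 < e i)
    (hX : HasLaw X (Measure.pi fun i => circularGaussian (d i)) μ)
    (hW : HasLaw W (Measure.pi fun i => circularGaussian (e i)) μ) :
    ∫ ω, logPDFRatio d e (X ω) (W ω) ∂μ = ∑ i, Real.log (d i / e i) := by
  have hXi := fun i => hasLaw_eval_pi_circularGaussian hX i
  have hWi := fun i => hasLaw_eval_pi_circularGaussian hW i
  have hXsq := fun i => (integrable_norm_sq_of_hasLaw (hXi i)).div_const (d i : ℝ)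
  have hWsq := fun i => (integrable_norm_sq_of_hasLaw (hWi i)).div_const (e i : ℝ)
  have hdiff : ∀ i, Integrable (fun ω => ‖X ω i‖ ^ 2 / d i - ‖W ω i‖ ^ 2 / e i) μ := fun i =>
    (hXsq i).sub (hWsq i)
  unfold logPDFRatio
  rw [integral_finsetSum _ fun i _ => by exact (integrable_const _).add (hdiff i)]
  refine Finset.sum_congr rfl fun i _ => ?_
  rw [integral_add (integrable_const _) (hdiff i), integral_sub (hXsq i) (hWsq i),
    integral_div, integral_div, integral_norm_sq_of_hasLaw (hXi i),
    integral_norm_sq_of_hasLaw (hWi i), div_self (NNReal.coe_ne_zero.2 (hd i).ne'),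
    div_self (NNReal.coe_ne_zero.2 (he i).ne')]
  simp only [integral_const, probReal_univ, one_smul, sub_self, add_zero]

variable {γ : Type*} [MeasurableSpace γ] {Y : Ω → γ} {h : γ → ι → ℂ}

lemma map_gaussianChannel_eq_withDensity (hd : ∀ i, 0 < d i) (he : ∀ i, 0 < e i)
    (hY : AEMeasurable Y μ) (hh : Measurable h)
    (hW : HasLaw W (Measure.pi fun i => circularGaussian (e i)) μ) (hYW : IndepFun Y W μ) :
    μ.map (fun ω => (h (Y ω) + W ω, Y ω)) =
      ((Measure.pi fun i => circularGaussian (d i)).prod (μ.map Y)).withDensity fun p =>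
        ENNReal.ofReal (Real.exp (logPDFRatio d e p.1 (p.1 - h p.2))) := by
  have := Measure.isProbabilityMeasure_map hY
  have hpdf : ∀ c : ι → ℝ≥0, Measurable fun z : ι → ℂ =>
      ENNReal.ofReal (∏ i, circularPDF (c i) (z i)) := fun c => by fun_prop
  have hpos : ∀ z : ι → ℂ, 0 < ∏ i, circularPDF (d i) (z i) := fun z =>
    Finset.prod_pos fun i _ => circularPDF_pos (hd i) _
  have hsum : (fun ω => (h (Y ω) + W ω, Y ω)) =
      (fun p : γ × (ι → ℂ) => (p.2 + h p.1, p.1)) ∘ fun ω => (Y ω, W ω) :=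
    funext fun ω => by simp only [Function.comp_apply, add_comm]
  rw [hsum, ← AEMeasurable.map_map_of_aemeasurable (by fun_prop) (hY.prodMk hW.aemeasurable),
    hYW.map_prod_eq_prod_map_map hY hW.aemeasurable, hW.map_eq,
    pi_circularGaussian_eq_withDensity he, pi_circularGaussian_eq_withDensity hd,
    map_add_prod_withDensity _ _ hh (hpdf e) (hpdf d) (fun z => by simpa using hpos z)
      fun z => ENNReal.ofReal_ne_top]
  simp_rw [← ofReal_prod_circularPDF_div hd he]

theorem mutualInfo_gaussianChannel (hd : ∀ i, 0 < d i) (he : ∀ i, 0 < e i)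
    (hY : AEMeasurable Y μ) (hh : Measurable h)
    (hW : HasLaw W (Measure.pi fun i => circularGaussian (e i)) μ) (hYW : IndepFun Y W μ)
    (hX : HasLaw (fun ω => h (Y ω) + W ω) (Measure.pi fun i => circularGaussian (d i)) μ) :
    mutualInfo (fun ω => h (Y ω) + W ω) Y μ = ENNReal.ofReal (∑ i, Real.log (d i / e i)) := by
  have hXY := hX.aemeasurable.prodMk hY
  have := Measure.isProbabilityMeasure_map hY
  have := Measure.isProbabilityMeasure_map hXY
  have hψ : Measurable fun p : (ι → ℂ) × γ => logPDFRatio d e p.1 (p.1 - h p.2) := by fun_prop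
  have hjoint := map_gaussianChannel_eq_withDensity hd he hY hh hW hYW
  have hnoise : ∀ ω, h (Y ω) + W ω - h (Y ω) = W ω := fun ω => add_sub_cancel_left _ _
  have hint : Integrable (fun p : (ι → ℂ) × γ => logPDFRatio d e p.1 (p.1 - h p.2))
      (μ.map fun ω => (h (Y ω) + W ω, Y ω)) := by
    rw [integrable_map_measure hψ.aestronglyMeasurable hXY]
    simpa only [Function.comp_def, hnoise] using integrable_logPDFRatio hX hW
  rw [mutualInfo, hX.map_eq, ← integral_logPDFRatio hd he hX hW,
    klDiv_eq_integral_of_eq_withDensity_exp hψ hjoint hint,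
    integral_map hXY hψ.aestronglyMeasurable]
  simp only [hnoise]

end GaussianChannel

section LinearGaussianModel

variable {ι J : Type*} [Fintype ι]

lemma exists_orthogonal_mul_mul_transpose_eq_diagonal [DecidableEq ι] {A : Matrix ι ι ℝ}
    (hA : A.PosSemidef) :
    ∃ (O : Matrix ι ι ℝ) (d : ι → ℝ≥0), O.transpose * O = 1 ∧ O * O.transpose = 1 ∧
      O * A * O.transpose = Matrix.diagonal fun i => (d i : ℝ) := by
  have hH := hA.isHermitian
  set U : Matrix ι ι ℝ := hH.eigenvectorUnitary.1 with hU
  have hstar : star U = U.transpose := by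
    rw [Matrix.star_eq_conjTranspose, Matrix.conjTranspose_eq_transpose_of_trivial]
  refine ⟨U.transpose, fun i => ⟨hH.eigenvalues i, hA.eigenvalues_nonneg i⟩, ?_, ?_, ?_⟩
  · rw [Matrix.transpose_transpose, ← hstar]
    exact Unitary.coe_mul_star_self hH.eigenvectorUnitary
  · rw [Matrix.transpose_transpose, ← hstar]
    exact Unitary.coe_star_mul_self hH.eigenvectorUnitary
  · have h := hH.conjStarAlgAut_star_eigenvectorUnitary
    rw [Unitary.conjStarAlgAut_star_apply, ← hU, hstar] at h
    rw [Matrix.transpose_transpose, h]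
    rfl

lemma gaussInfo_eq_sum_log [DecidableEq ι] {H : Type*} [NormedAddCommGroup H]
    [InnerProductSpace ℝ H] {x : ι → H} {O : Matrix ι ι ℝ} {d : ι → ℝ≥0}
    (hO : O * O.transpose = 1)
    (hd : O * Matrix.gram ℝ x * O.transpose = Matrix.diagonal fun i => (d i : ℝ)) :
    gaussInfo x = ∑ i, Real.log (1 + d i) := by
  have hconj : O * (1 + Matrix.gram ℝ x) * O.transpose =
      Matrix.diagonal fun i => (1 + d i : ℝ) := by
    rw [mul_add, add_mul, mul_one, hO, hd, ← Matrix.diagonal_one, Matrix.diagonal_add]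
  have hdet : (1 + Matrix.gram ℝ x).det = ∏ i, (1 + d i : ℝ) := by
    rw [← Matrix.det_diagonal, ← hconj, Matrix.det_mul, Matrix.det_mul, mul_right_comm,
      ← Matrix.det_mul, hO, Matrix.det_one, one_mul]
  rw [gaussInfo, hdet, Real.log_prod fun i _ => by positivity]

lemma hasSum_mul_mul_apply {κ : Type*} {t : J → ℝ} {a : Matrix ι J ℝ} {G : Matrix ι ι ℝ}
    (ha : ∀ i k, HasSum (fun j => t j * (a i j * a k j)) (G i k)) (O : Matrix κ ι ℝ) (i k : κ) :
    HasSum (fun j => t j * ((O * a) i j * (O * a) k j)) ((O * G * O.transpose) i k) := by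
  simp_rw [Matrix.mul_apply, Matrix.transpose_apply, Finset.sum_mul_sum, Finset.sum_mul,
    Finset.mul_sum]
  rw [Finset.sum_comm]
  refine hasSum_sum fun l _ => hasSum_sum fun m _ => ?_
  rw [mul_right_comm]
  refine ((ha l m).mul_left (O i l * O k m)).congr_fun fun j => ?_
  ring

lemma summable_mul_apply_sq {κ : Type*} {a : Matrix ι J ℝ} (ha : ∀ i, Summable fun j => a i j ^ 2)
    (O : Matrix κ ι ℝ) (i : κ) : Summable fun j => (O * a) i j ^ 2 := by
  refine .of_nonneg_of_le (fun j => sq_nonneg _)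
    (fun j => sq_sum_le_card_mul_sum_sq (s := Finset.univ) (f := fun k => O i k * a k j)) ?_
  simp_rw [mul_pow]
  exact (summable_sum fun k _ => (ha k).mul_left _).mul_left _

lemma tsum_mul_apply_mul {κ : Type*} {a : Matrix ι J ℝ} {z : J → ℂ}
    (hz : ∀ k, Summable fun j => (a k j : ℂ) * z j) (O : Matrix κ ι ℝ) (i : κ) :
    ∑' j, ((O * a) i j : ℂ) * z j =
      (O.map Complex.ofReal).mulVec (fun k => ∑' j, (a k j : ℂ) * z j) i := by
  simp_rw [Matrix.mul_apply, Complex.ofReal_sum, Complex.ofReal_mul, Finset.sum_mul, mul_assoc]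
  rw [Summable.tsum_finsetSum fun k _ => (hz k).mul_left _]
  exact Finset.sum_congr rfl fun k _ => tsum_mul_left

variable [DecidableEq ι]

lemma leftInverse_mulVec_map_ofReal {O O' : Matrix ι ι ℝ} (h : O' * O = 1) :
    Function.LeftInverse (O'.map Complex.ofReal).mulVec (O.map Complex.ofReal).mulVec := by
  intro z
  have hmap : O'.map Complex.ofReal * O.map Complex.ofReal = 1 := by
    change O'.map Complex.ofRealHom * O.map Complex.ofRealHom = 1
    rw [← Matrix.map_mul, h, Matrix.map_one _ (map_zero _) (map_one _)]
  rw [Matrix.mulVec_mulVec, hmap, Matrix.one_mulVec]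

variable [Countable J] {Ω : Type*} [MeasurableSpace Ω] {μ : Measure Ω} [IsProbabilityMeasure μ]
  {W : Ω → ι → ℂ} {v : ℝ≥0} {β : J → Ω → ℂ} {t : J → ℝ≥0}

lemma hasLaw_mulVec_orthogonal (hW : HasLaw W (Measure.pi fun _ => circularGaussian v) μ)
    {O : Matrix ι ι ℝ} (hO : O * O.transpose = 1) :
    HasLaw (fun ω => (O.map Complex.ofReal).mulVec (W ω))
      (Measure.pi fun _ => circularGaussian v) μ := by
  have hWi := fun i => hasLaw_eval_pi_circularGaussian (d := fun _ => v) hW i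
  have hcov : ∀ i k, HasSum (fun j => (v : ℝ) * (O i j * O k j))
      (Matrix.diagonal (fun _ => (v : ℝ)) i k) := by
    intro i k
    have hrow : ∑ j, (v : ℝ) * (O i j * O k j) = Matrix.diagonal (fun _ => (v : ℝ)) i k := by
      rw [← Finset.mul_sum, ← Matrix.smul_one_eq_diagonal, ← hO]
      rfl
    exact hrow ▸ hasSum_fintype _
  have h := hasLaw_tsum_mul hWi ((iIndepFun_iff_hasLaw_pi_pi hWi).2 hW) .of_finite
    (fun _ => .of_finite) hcov
  simp only [tsum_fintype] at h
  exact h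

lemma mutualInfo_tsum_add_of_diagonal (hβ : ∀ j, HasLaw (β j) (circularGaussian (t j)) μ)
    (hβ_indep : iIndepFun β μ) (ht : Summable t) (hv : 0 < v)
    (hW : HasLaw W (Measure.pi fun _ => circularGaussian v) μ)
    (hβW : IndepFun (fun ω j => β j ω) W μ) {b : Matrix ι J ℝ}
    (hb : ∀ i, Summable fun j => b i j ^ 2) {d : ι → ℝ≥0}
    (hbd : ∀ i k, HasSum (fun j => t j * (b i j * b k j))
      (Matrix.diagonal (fun i => (v * d i : ℝ)) i k)) :
    mutualInfo (fun ω => (fun i => ∑' j, (b i j : ℂ) * β j ω) + W ω) (fun ω j => β j ω) μ =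
      ENNReal.ofReal (∑ i, Real.log (1 + d i)) := by
  have hmeas : Measurable fun (y : J → ℂ) i => ∑' j, (b i j : ℂ) * y j :=
    measurable_pi_lambda _ fun i => Measurable.tsum fun j => by fun_prop
  have hY : AEMeasurable (fun ω j => β j ω) μ :=
    aemeasurable_pi_lambda _ fun j => (hβ j).aemeasurable
  have hsignal := hasLaw_tsum_mul (d := fun i => v * d i) hβ hβ_indep ht hb hbd
  have hX := hasLaw_add_pi_circularGaussian hsignal hW (hβW.comp hmeas measurable_id)
  have hratio : ∀ i, ((v * d i + v : ℝ≥0) : ℝ) / v = 1 + d i := fun i => by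
    push_cast
    field_simp
    ring
  simp_rw [← hratio]
  exact mutualInfo_gaussianChannel (fun i => by positivity) (fun _ => hv) hY hmeas hW hβW hX

theorem mutualInfo_tsum_add_eq_gaussInfo (hβ : ∀ j, HasLaw (β j) (circularGaussian (t j)) μ)
    (hβ_indep : iIndepFun β μ) (ht : Summable t) (hv : 0 < v)
    (hW : HasLaw W (Measure.pi fun _ => circularGaussian v) μ)
    (hβW : IndepFun (fun ω j => β j ω) W μ) {a : Matrix ι J ℝ}
    (ha : ∀ i, Summable fun j => a i j ^ 2)
    {H : Type*} [NormedAddCommGroup H] [InnerProductSpace ℝ H] {x : ι → H}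
    (hx : ∀ i k, HasSum (fun j => t j * (a i j * a k j)) (v * ⟪x i, x k⟫)) :
    mutualInfo (fun ω => (fun i => ∑' j, (a i j : ℂ) * β j ω) + W ω) (fun ω j => β j ω) μ =
      ENNReal.ofReal (gaussInfo x) := by
  obtain ⟨O, d, hOO, hOO', hd⟩ := exists_orthogonal_mul_mul_transpose_eq_diagonal
    (Matrix.posSemidef_gram ℝ x)
  have hbd : ∀ i k, HasSum (fun j => t j * ((O * a) i j * (O * a) k j))
      (Matrix.diagonal (fun i => (v * d i : ℝ)) i k) := by
    have hsmul : Matrix.diagonal (fun i => (v * d i : ℝ)) =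
        O * ((v : ℝ) • Matrix.gram ℝ x) * O.transpose := by
      rw [Matrix.mul_smul, Matrix.smul_mul, hd, ← Matrix.diagonal_smul]
      rfl
    rw [hsmul]
    exact hasSum_mul_mul_apply hx O
  have hX : AEMeasurable (fun ω => (fun i => ∑' j, (a i j : ℂ) * β j ω) + W ω) μ :=
    (aemeasurable_pi_lambda _ fun i => AEMeasurable.tsum fun j =>
      (hβ j).aemeasurable.const_mul _).add hW.aemeasurable
  have hmulVec : ∀ A : Matrix ι ι ℝ, Measurable (A.map Complex.ofReal).mulVec := fun A => by
    fun_prop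
  have hrot : (fun ω => (O.map Complex.ofReal).mulVec
      ((fun i => ∑' j, (a i j : ℂ) * β j ω) + W ω)) =ᵐ[μ]
      fun ω => (fun i => ∑' j, ((O * a) i j : ℂ) * β j ω) +
        (O.map Complex.ofReal).mulVec (W ω) := by
    filter_upwards [ae_forall_summable_mul hβ ht] with ω hω
    rw [Matrix.mulVec_add, funext (tsum_mul_apply_mul (fun k => hω _ (ha k)) O)]
  rw [← mutualInfo_comp_eq_of_leftInverse hX
    (aemeasurable_pi_lambda _ fun j => (hβ j).aemeasurable) (hmulVec O) (hmulVec O.transpose)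
    (leftInverse_mulVec_map_ofReal hOO), mutualInfo_congr hrot,
    mutualInfo_tsum_add_of_diagonal hβ hβ_indep ht hv (hasLaw_mulVec_orthogonal hW hOO')
      (hβW.comp measurable_id (hmulVec O)) (summable_mul_apply_sq ha O) hbd,
    gaussInfo_eq_sum_log hOO' hd]

end LinearGaussianModel

section ArrayModel

variable {Ω : Type*} [MeasurableSpace Ω] {μ : Measure Ω} {s : ℤ → ℝ≥0} {v : ℝ≥0}
  {β : ℤ → Ω → ℂ} {w : ℝ → Ω → ℂ}

/-- The law of the model: independent coefficients `β m ∼ CN(0, s m)` of the scene and, independent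
of them, independent noise variables `w x ∼ CN(0, v)` at all positions. -/
structure IsArrayModel (μ : Measure Ω) (s : ℤ → ℝ≥0) (v : ℝ≥0) (β : ℤ → Ω → ℂ)
    (w : ℝ → Ω → ℂ) : Prop where
  hasLaw_coeff (m : ℤ) : HasLaw (β m) (circularGaussian (s m)) μ
  hasLaw_noise (x : ℝ) : HasLaw (w x) (circularGaussian v) μ
  iIndepFun_coeff : iIndepFun β μ
  iIndepFun_noise : iIndepFun w μ
  indepFun_coeff_noise : IndepFun (fun ω m => β m ω) (fun ω x => w x ω) μ

namespace IsArrayModel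

lemma hasLaw_noise_restrict (h : IsArrayModel μ s v β w) (T : Finset ℝ) :
    HasLaw (fun ω (x : T) => w x ω) (Measure.pi fun _ => circularGaussian v) μ := by
  have hindep : iIndepFun (fun x : T => w x) μ := h.iIndepFun_noise.precomp Subtype.val_injective
  exact hindep.hasLaw_pi (μ := fun _ => circularGaussian v) fun x => h.hasLaw_noise x

theorem fullInfo_eq [IsProbabilityMeasure μ] (h : IsArrayModel μ s v β w) (hs : Summable s)
    (hv : 0 < v) (lam : ℝ) (T : Finset ℝ) :
    fullInfo μ lam β w T =
      ENNReal.ofReal (gaussInfoOn (sceneVec lam (hs.div_const v)) T) := by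
  refine mutualInfo_tsum_add_eq_gaussInfo h.hasLaw_coeff h.iIndepFun_coeff hs hv
    (h.hasLaw_noise_restrict T)
    (h.indepFun_coeff_noise.comp measurable_id
      (ψ := fun (z : ℝ → ℂ) (x : T) => z x) (by fun_prop))
    (a := Matrix.of fun x m => coeff lam x m) (fun x => summable_coeff_sq lam x) fun x y => ?_
  refine ((hasSum_inner_sceneVec lam (hs.div_const v) x y).mul_left (v : ℝ)).congr_fun fun m => ?_
  rw [Matrix.of_apply, Matrix.of_apply, NNReal.coe_div, ← mul_assoc (v : ℝ),
    mul_div_cancel₀ _ (NNReal.coe_pos.2 hv).ne']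

theorem truncInfo_eq [IsProbabilityMeasure μ] (h : IsArrayModel μ s v β w) (hs : Summable s)
    (hv : 0 < v) (lam : ℝ) (M : Finset ℤ) (T : Finset ℝ) :
    truncInfo μ lam M β w T = ENNReal.ofReal
      (gaussInfoOn (sceneVec lam (NNReal.indicator_summable (hs.div_const v) M)) T) := by
  have hread : truncReading lam M β w T =
      fun ω => (fun x : T => ∑' m : M, (coeff lam x m : ℂ) * β m ω) + fun x : T => w x ω := by
    funext ω x
    rw [truncReading, Pi.add_apply, tsum_fintype,
      Finset.sum_coe_sort M fun m => (coeff lam x m : ℂ) * β m ω]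
  rw [truncInfo, hread]
  refine mutualInfo_tsum_add_eq_gaussInfo (fun m : M => h.hasLaw_coeff m)
    (h.iIndepFun_coeff.precomp Subtype.val_injective) Summable.of_finite hv
    (h.hasLaw_noise_restrict T)
    (h.indepFun_coeff_noise.comp (φ := fun (z : ℤ → ℂ) (m : M) => z m)
      (ψ := fun (z : ℝ → ℂ) (x : T) => z x) (by fun_prop) (by fun_prop))
    (a := Matrix.of fun x m => coeff lam x m) (fun x => Summable.of_finite) fun x y => ?_
  have hsum := (hasSum_inner_sceneVec lam
    (NNReal.indicator_summable (hs.div_const v) M) x y).mul_left (v : ℝ)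
  rw [← hasSum_subtype_iff_of_support_subset (s := (M : Set ℤ)) fun m hm => ?_] at hsum
  · refine hsum.congr_fun fun m => ?_
    rw [Function.comp_apply, Set.indicator_of_mem m.2, NNReal.coe_div, Matrix.of_apply,
      Matrix.of_apply, ← mul_assoc (v : ℝ), mul_div_cancel₀ _ (NNReal.coe_pos.2 hv).ne']
  · by_contra hmM
    exact hm (by simp only [Set.indicator_of_notMem hmM, NNReal.coe_zero, zero_mul, mul_zero])

end IsArrayModel

lemma gaussInfoOn_sceneVec_le_indicator_add {ρ : ℤ → ℝ≥0} (hρ : Summable ρ) (lam : ℝ) (M : Set ℤ)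
    {N : ℕ} {T : Finset ℝ} (hT : T.card ≤ N) :
    gaussInfoOn (sceneVec lam hρ) T ≤
      gaussInfoOn (sceneVec lam (NNReal.indicator_summable hρ M)) T +
        T.card * Real.log (1 + N * ∑' m, Mᶜ.indicator ρ m) := by
  rw [← sceneVec_indicator_add_compl lam hρ M]
  refine gaussInfoOn_add_orthogonal_le (inner_sceneVec_indicator_compl lam hρ M) (fun x => ?_) hT
  simpa only [← NNReal.coe_pow, NNReal.sq_sqrt] using
    pow_le_pow_left₀ (norm_nonneg _) (norm_sceneVec_le lam (NNReal.indicator_summable hρ Mᶜ) x) 2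

end ArrayModel

section Penalty

lemma natCast_le_rpow_three_halves (N : ℕ) : (N : ℝ) ≤ (N : ℝ) ^ (3 / 2 : ℝ) := by
  rcases N.eq_zero_or_pos with rfl | hN
  · simpa only [Nat.cast_zero] using Real.rpow_nonneg le_rfl _
  · exact Real.self_le_rpow_of_one_le (Nat.one_le_cast.2 hN) (by norm_num)

lemma one_add_mul_le_inv_one_sub_mul {e n r : ℝ} (he : 0 ≤ e) (hnr : n ≤ r) (hn : 0 ≤ n)
    (her : e * r < 1) : 1 + n * e ≤ (1 - e * r)⁻¹ := by
  rw [← one_div, le_div_iff₀ (sub_pos.2 her)]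
  nlinarith [mul_le_mul_of_nonneg_left hnr he, mul_nonneg (mul_nonneg hn he)
    (mul_nonneg he (hn.trans hnr))]

lemma log_penalty_le {lam v P ε δ R : ℝ} {N k : ℕ} (hlam : 0 < lam) (hv : 0 < v) (hP : 0 ≤ P)
    (hε : 0 ≤ ε) (hδ : 0 ≤ δ) (hNR : N ≤ R) (hεR : ε * R < v) (hkN : k ≤ N) :
    N * Real.log (1 + 4 * δ * (P / v) * R / lam) + k * Real.log (1 + N * (ε / v)) ≤
      N * Real.log ((lam * v + 4 * δ * P * (1 + δ) * R) / (lam * v - ε * lam * R)) := by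
  have hR : 0 ≤ R := N.cast_nonneg.trans hNR
  have hεv : ε / v * R < 1 := by rwa [div_mul_eq_mul_div, div_lt_one hv]
  have hgap : 0 < 1 - ε / v * R := sub_pos.2 hεv
  have hfactor : (lam * v + 4 * δ * P * (1 + δ) * R) / (lam * v - ε * lam * R) =
      (1 + 4 * δ * (P / v) * (1 + δ) * R / lam) * (1 - ε / v * R)⁻¹ := by
    rw [show lam * v - ε * lam * R = lam * v * (1 - ε / v * R) by field_simp]
    field_simp
  have hgrid : Real.log (1 + 4 * δ * (P / v) * R / lam) ≤
      Real.log (1 + 4 * δ * (P / v) * (1 + δ) * R / lam) := by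
    have hδP : 4 * δ * (P / v) ≤ 4 * δ * (P / v) * (1 + δ) :=
      le_mul_of_one_le_right (by positivity) (le_add_of_nonneg_right hδ)
    gcongr
  have htail : k * Real.log (1 + N * (ε / v)) ≤ N * Real.log (1 - ε / v * R)⁻¹ := by
    gcongr
    · exact Real.log_nonneg (le_add_of_nonneg_right (by positivity))
    · exact one_add_mul_le_inv_one_sub_mul (by positivity) hNR N.cast_nonneg hεv
  rw [hfactor, Real.log_mul (by positivity) (inv_pos.2 hgap).ne', mul_add]
  exact add_le_add (mul_le_mul_of_nonneg_left hgrid N.cast_nonneg) htail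

end Penalty

section SceneGreedy

variable {ρ : ℤ → ℝ≥0} {lam δ : ℝ} {A : Set ℝ} {V S Sgr : Finset ℝ} {N : ℕ}

theorem GreedyRun.one_sub_inv_exp_mul_gaussInfoOn_sceneVec_le {hρ : Summable ρ}
    (hgr : GreedyRun (gaussInfoOn (sceneVec lam hρ)) V N Sgr) (hV : IsUniformGrid A δ V)
    (hδ : 0 < δ) (hlam : 0 < lam) (hS : (S : Set ℝ) ⊆ A) (hcard : S.card ≤ N) :
    (1 - 1 / Real.exp 1) * (gaussInfoOn (sceneVec lam hρ) S -
        N * Real.log (1 + 4 * δ * (∑' m, ρ m) * (N : ℝ) ^ (3 / 2 : ℝ) / lam)) ≤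
      gaussInfoOn (sceneVec lam hρ) Sgr := by
  have hsq : (NNReal.sqrt (∑' m, ρ m) : ℝ) * NNReal.sqrt (∑' m, ρ m) = ∑' m, ρ m := by
    rw [← NNReal.coe_mul, NNReal.mul_self_sqrt]
  have hconst : 4 / Real.pi * NNReal.sqrt (∑' m, ρ m) *
      (NNReal.sqrt (∑' m, ρ m) * (Real.pi / lam).toNNReal : ℝ≥0) * δ * (N : ℝ) ^ (3 / 2 : ℝ) =
      4 * δ * (∑' m, ρ m) * (N : ℝ) ^ (3 / 2 : ℝ) / lam := by
    rw [NNReal.coe_mul, Real.coe_toNNReal _ (by positivity), ← hsq]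
    field_simp
  rw [← hconst]
  exact hgr.one_sub_inv_exp_mul_gaussInfoOn_le hV hδ (norm_sceneVec_le lam hρ)
    (lipschitzWith_sceneVec hlam hρ) hS hcard

theorem GreedyRun.one_sub_inv_exp_mul_gaussInfoOn_truncated_le {hρ : Summable ρ} {M : Set ℤ}
    (hgr : GreedyRun (gaussInfoOn (sceneVec lam (NNReal.indicator_summable hρ M))) V N Sgr)
    (hV : IsUniformGrid A δ V) (hδ : 0 < δ) (hlam : 0 < lam) (hS : (S : Set ℝ) ⊆ A)
    (hcard : S.card ≤ N) :
    (1 - 1 / Real.exp 1) * (gaussInfoOn (sceneVec lam hρ) S -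
        (N * Real.log (1 + 4 * δ * (∑' m, ρ m) * (N : ℝ) ^ (3 / 2 : ℝ) / lam) +
          S.card * Real.log (1 + N * ∑' m, Mᶜ.indicator ρ m))) ≤
      gaussInfoOn (sceneVec lam (NNReal.indicator_summable hρ M)) Sgr := by
  have hpower : ((∑' m, M.indicator ρ m : ℝ≥0) : ℝ) ≤ (∑' m, ρ m : ℝ≥0) :=
    NNReal.coe_le_coe.2 <| (NNReal.indicator_summable hρ M).tsum_le_tsum
      (fun m => Set.indicator_le_self M ρ m) hρ
  refine le_trans (mul_le_mul_of_nonneg_left ?_ one_sub_inv_exp_nonneg)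
    (hgr.one_sub_inv_exp_mul_gaussInfoOn_sceneVec_le hV hδ hlam hS hcard)
  rw [← sub_sub, sub_right_comm]
  refine sub_le_sub (sub_le_iff_le_add.2 (gaussInfoOn_sceneVec_le_indicator_add hρ lam M hcard)) ?_
  gcongr

end SceneGreedy

end ArrayDesign

theorem corollary1
    {Ω : Type*} [MeasurableSpace Ω] (μ : Measure Ω) [IsProbabilityMeasure μ]
    -- wavelength, coefficient variances, noise variance, scene coefficients, sensor noise
    (lam : ℝ) (hlam : 0 < lam)
    (s : ℤ → ℝ≥0) (hs : Summable s)
    (v : ℝ≥0) (hv : 0 < v)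
    (β : ℤ → Ω → ℂ) (w : ℝ → Ω → ℂ)
    (hβ : ∀ m, HasLaw (β m) (ArrayDesign.circularGaussian (s m)) μ)
    (hw : ∀ x, HasLaw (w x) (ArrayDesign.circularGaussian v) μ)
    (hβ_indep : iIndepFun β μ)
    (hw_indep : iIndepFun w μ)
    (hβw_indep : IndepFun (fun ω m => β m ω) (fun ω x => w x ω) μ)
    -- expected scene power, truncation set, truncation error, number of sensors
    (P : ℝ) (hP : P = ∑' m : ℤ, (s m : ℝ))
    (M : Finset ℤ) (ε : ℝ) (hε : ε = ∑' m : {m : ℤ // m ∉ M}, (s m.1 : ℝ))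
    (N : ℕ) (hεN : ε * (N : ℝ) ^ (3 / 2 : ℝ) < (v : ℝ))
    -- aperture and grid
    (A : Set ℝ) (δ : ℝ) (hδ : 0 < δ)
    (V : Finset ℝ) (hV : ArrayDesign.IsUniformGrid A δ V)
    -- output of the greedy algorithm
    (Sgr : Finset ℝ)
    (hgr : ArrayDesign.GreedyRun
      (fun T => (ArrayDesign.truncInfo μ lam M β w T).toReal) V N Sgr) :
    (∀ T : Finset ℝ, ArrayDesign.fullInfo μ lam β w T ≠ ∞ ∧
      ArrayDesign.truncInfo μ lam M β w T ≠ ∞) ∧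
    ∀ S : Finset ℝ, (S : Set ℝ) ⊆ A → S.card ≤ N →
      (1 - 1 / Real.exp 1) *
        ((ArrayDesign.fullInfo μ lam β w S).toReal -
          N * Real.log ((lam * v + 4 * δ * P * (1 + δ) * (N : ℝ) ^ (3 / 2 : ℝ)) /
            (lam * v - ε * lam * (N : ℝ) ^ (3 / 2 : ℝ))))
        ≤ (ArrayDesign.truncInfo μ lam M β w Sgr).toReal := by
  have hmodel : ArrayDesign.IsArrayModel μ s v β w := ⟨hβ, hw, hβ_indep, hw_indep, hβw_indep⟩
  have hfull := hmodel.fullInfo_eq hs hv lam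
  have htrunc := hmodel.truncInfo_eq hs hv lam M
  refine ⟨fun T => ⟨hfull T ▸ ENNReal.ofReal_ne_top, htrunc T ▸ ENNReal.ofReal_ne_top⟩,
    fun S hS hcard => ?_⟩
  simp only [htrunc, hfull, ENNReal.toReal_ofReal (ArrayDesign.gaussInfoOn_nonneg _ _)] at hgr ⊢
  have hpower : ((∑' m, s m / v : ℝ≥0) : ℝ) = P / v := by
    rw [hP, tsum_div_const, NNReal.coe_div, NNReal.coe_tsum]
  have htail : ((∑' m, (M : Set ℤ)ᶜ.indicator (fun m => s m / v) m : ℝ≥0) : ℝ) = ε / v := by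
    rw [hε, ← tsum_subtype, tsum_div_const, NNReal.coe_div, NNReal.coe_tsum]
    rfl
  have hgreedy := hgr.one_sub_inv_exp_mul_gaussInfoOn_truncated_le (hρ := hs.div_const v)
    hV hδ hlam hS hcard
  rw [hpower, htail] at hgreedy
  refine (mul_le_mul_of_nonneg_left (sub_le_sub_left ?_ _)
    ArrayDesign.one_sub_inv_exp_nonneg).trans hgreedy
  exact ArrayDesign.log_penalty_le hlam hv (hP ▸ tsum_nonneg fun m => (s m).coe_nonneg)
    (hε ▸ tsum_nonneg fun m => (s m).coe_nonneg) hδ.le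
    (ArrayDesign.natCast_le_rpow_three_halves N) hεN hcard
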